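/- \textbf{Setting.} Let $k\ge 1$, $T\in\mathbb N$, and let $\mathcal K\subset\mathbb R^k$ be closed and convex with $r\mathbb B^k\subseteq\mathcal K\subseteq R\,\mathbb B^k$ for some $0<r<R$ and $\|x-y\|\le D$ for all $x,y\in\mathcal K$ (Euclidean norm). Let $f_1,\dots,f_T:\mathcal K\to\mathbb R$ be convex and differentiable with $\|\nabla f_t(x)\|\le G$ and $|f_t(x)|\le M$ for all $x\in\mathcal K$, where $G,M>0$; put $\nu=\frac{M}{Gr}$. The prediction of round $t$ is requested at time $l_t$ and its feedback arrives at time $r_t>l_t$, where $0<l_1<\dots<l_T$ and all timestamps $l_t,r_t$ are distinct; put $I_t=(l_t,r_t)$. Losses and timestamps are arbitrary and fixed in advance (oblivious adversary). Define the delays $d_t=|\{s:l_s\in I_t\}|$ (so feedback $t$ arrives in round $t+d_t$), $d_{\mathrm{tot}}=\sum_{t=1}^T d_t$, the dual delays $d^\star_t=|\{s:r_s\in I_t\}|$, the dual backlogs $\sigma^\star_t=|\{s:r_t\in I_s\}|$, and the permutation $\rho$ of $\{1,\dots,T\}$ with $r_{\rho(1)}<\dots<r_{\rho(T)}$. \textbf{Base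 algorithm (P-FTRL).} Given a starting point $z_1\in\mathcal K$, learning rates $\eta_n>0$ and successively revealed loss vectors $c_1,c_2,\dots$, it predicts \[ z_{n+1}=\operatorname*{arg\,min}_{z\in\mathcal K}\ \sum_{m=1}^n\Bigl(\langle c_m,z\rangle+\tfrac{\alpha_m}{2}\|z_m-z\|^2\Bigr),\qquad \alpha_1=\tfrac1{\eta_1},\quad \alpha_{m+1}=\tfrac1{\eta_{m+1}}-\tfrac1{\eta_m}. \] \textbf{Wrapper $\mathcal W_{\mathrm{BCO}}$.} Let $\bar z$ denote the current output of the base algorithm $\mathcal B$, initially $z_1$. In each round $t=1,\dots,T$ sample $u_t\sim\mathrm{Unif}(\mathbb S^{k-1})$ independently of the past and predict $x_t=(1-\frac{\delta_t}{r})\bar z+\delta_t u_t$; then, for each $s$ with $s+d_s=t$, in the order of observation, receive $f_s(x_s)$, send $\bigl(\frac{k}{\delta_s}f_s(x_s)u_s,\,d^\star_s,\,\sigma^\star_s\bigr)$ to $\mathcal B$ (the first entry being the next loss vector), and update $\bar z$. \textbf{Statement.} There is a universal constant $C>0$ such that the following holds in the above setting for every choice of $k$, $T$, $\mathcal K$,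 $r$, $R$, $D$, $G$, $M$, losses, timestamps and $z_1\in\mathcal K$. Let $\delta_t=r\min\bigl\{1,\frac{\sqrt{\nu k}}{t^{1/4}}\bigr\}$ for all $t$, or $\delta_t=r\min\bigl\{1,\frac{\sqrt{\nu k}}{T^{1/4}}\bigr\}$ for all $t$, and let $\mathcal B$ be P-FTRL with \[ \eta_n=\frac{D/G}{\sqrt{\,n+\sum_{m=1}^n\bigl(\sigma^\star_{\rho(m)}+(\nu k r/\delta'_m)^2\bigr)}},\qquad \delta'_m=\delta_{\rho(m)+d_{\rho(m)}}. \] Then for $x^*\in\operatorname*{arg\,min}_{x\in\mathcal K}\sum_{t=1}^T f_t(x)$ the regret of $\mathcal W_{\mathrm{BCO}}(\mathcal B)$ is integrable and \[ \mathbb E\Bigl[\sum_{t=1}^T\bigl(f_t(x_t)-f_t(x^*)\bigr)\Bigr]\ \le\ C\,G D\Bigl[\sqrt{d_{\mathrm{tot}}}+T^{3/4}\sqrt{\nu k}\Bigr]. \] -/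

import Mathlib

open MeasureTheory

/-- The Euclidean space `ℝ^k`. -/
abbrev Eucl (k : ℕ) : Type := EuclideanSpace ℝ (Fin k)

/-- The unit sphere `S^{k-1}` of `ℝ^k`. -/
abbrev USphere (k : ℕ) : Type := Metric.sphere (0 : Eucl k) 1

/-- The uniform distribution on `S^{k-1}`: normalized surface measure. -/
noncomputable def unifSphere (k : ℕ) : Measure (USphere k) :=
  ((volume : Measure (Eucl k)).toSphere Set.univ)⁻¹ • (volume : Measure (Eucl k)).toSphere

/-! ### Timing of predictions and observations

Rounds are indexed by `Fin T`; the index `t` stands for round number `t + 1`. -/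

/-- Latency intervals `I_t = (l_t, r_t)`: the prediction of round `t` is requested at time `l_t`
and its feedback is revealed at time `r_t`. All timestamps are distinct. -/
structure Timeline (T : ℕ) where
  l : Fin T → ℝ
  r : Fin T → ℝ
  l_pos : ∀ t, 0 < l t
  l_strictMono : StrictMono l
  l_lt_r : ∀ t, l t < r t
  r_injective : Function.Injective r
  l_ne_r : ∀ s t, l s ≠ r t

namespace Timeline

variable {T : ℕ} (τ : Timeline T)

/-- The latency interval `I_t`. -/
def interval (t : Fin T) : Set ℝ := Set.Ioo (τ.l t) (τ.r t)

open Classical in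
/-- The delay `d_t`: the number of predictions made while feedback `t` is outstanding. -/
noncomputable def delay (t : Fin T) : ℕ :=
  (Finset.univ.filter fun s => τ.l s ∈ τ.interval t).card

open Classical in
/-- The dual delay: the number of observations received while feedback `t` is outstanding. -/
noncomputable def dualDelay (t : Fin T) : ℕ :=
  (Finset.univ.filter fun s => τ.r s ∈ τ.interval t).card

open Classical in
/-- The dual backlog: the number of predictions awaiting feedback when feedback `t` arrives. -/
noncomputable def dualBacklog (t : Fin T) : ℕ :=
  (Finset.univ.filter fun s => τ.r t ∈ τ.interval s).card

/-- The total delay. -/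
noncomputable def totalDelay : ℕ := ∑ t, τ.delay t

/-- The observation order: the permutation `ρ` of the rounds along which `r` is increasing. -/
noncomputable def obsOrder : Equiv.Perm (Fin T) := Tuple.sort τ.r

/-- The rounds `s` with `s + d_s = t`, whose feedback arrives in round `t`, in observation
order. -/
noncomputable def observedIn (t : Fin T) : List (Fin T) :=
  ((List.finRange T).map τ.obsOrder).filter fun (s : Fin T) => (s : ℕ) + τ.delay s = (t : ℕ)

end Timeline

/-! ### Online linear optimization with drift penalization, and P-FTRL -/

/-- A (deterministic) base algorithm: it maps the tuples (loss vector, lag, number of outstanding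
lags) revealed so far, oldest first, to its next prediction. -/
abbrev OLOAlgorithm (k : ℕ) : Type := List (Eucl k × ℕ × ℕ) → Eucl k

/-- A minimizer of `φ` over `K`, if there is one. -/
noncomputable def argminOn {k : ℕ} (K : Set (Eucl k)) (φ : Eucl k → ℝ) : Eucl k :=
  Classical.epsilon fun z => z ∈ K ∧ IsMinOn φ K z

/-- The regularization weights `α_1 = 1/η_1`, `α_{n+1} = 1/η_{n+1} - 1/η_n`. -/
noncomputable def pftrlWeight (η : ℕ → ℝ) : ℕ → ℝ
  | 0 => 0
  | 1 => 1 / η 1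
  | n + 2 => 1 / η (n + 2) - 1 / η (n + 1)

/-- The P-FTRL iterates: `pftrlIterate K z₁ η c n` is `z_{n+1}`, the prediction after the loss
vectors `c 0, …, c (n-1)`. With `c_{m+1} = c m`,
`z_{n+1} = argmin_{z ∈ K} ∑_{m=1}^{n} (⟨c_m, z⟩ + α_m ‖z_m - z‖² / 2)`. -/
noncomputable def pftrlIterate {k : ℕ} (K : Set (Eucl k)) (z₁ : Eucl k) (η : ℕ → ℝ)
    (c : ℕ → Eucl k) : ℕ → Eucl k
  | 0 => z₁
  | n + 1 => argminOn K fun z => ∑ m : Fin (n + 1),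
      (inner ℝ (c (m : ℕ)) z
        + pftrlWeight η ((m : ℕ) + 1) * ‖pftrlIterate K z₁ η c (m : ℕ) - z‖ ^ 2 / 2)
  termination_by n => n
  decreasing_by exact m.isLt

/-- P-FTRL with domain `K`, initial point `z₁` and learning rates `η_1, η_2, …`. -/
noncomputable def pftrl {k : ℕ} (K : Set (Eucl k)) (z₁ : Eucl k) (η : ℕ → ℝ) : OLOAlgorithm k :=
  fun h => pftrlIterate K z₁ η (fun m => (h.getD m 0).1) h.length

/-! ### The bandit wrapper -/

/-- The state of the wrapper: the tuples sent to the base algorithm so far, and the predictions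
made so far (`0` for future rounds). -/
structure WrapperState (k T : ℕ) where
  sent : List (Eucl k × ℕ × ℕ)
  pred : Fin T → Eucl k

section Wrapper

variable {k T : ℕ} (B : OLOAlgorithm k) (r : ℝ) (δ : ℕ → ℝ) (τ : Timeline T)
  (f : Fin T → Eucl k → ℝ) (u : Fin T → USphere k)

/-- Round `t`: predict `x_t = (1 - δ_t/r) z̄ + δ_t u_t`, where `z̄` is the current output of the
base algorithm; then, for every `s` with `s + d_s = t` in observation order, receive `f_s(x_s)` and
send the single-point gradient estimate `(k/δ_s) f_s(x_s) u_s`, the dual delay and the dual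
backlog of `s` to the base algorithm. `δ` takes round numbers `1, 2, …`. -/
noncomputable def wrapperRound (t : Fin T) (S : WrapperState k T) : WrapperState k T :=
  let x : Fin T → Eucl k := Function.update S.pred t
    ((1 - δ ((t : ℕ) + 1) / r) • B S.sent + δ ((t : ℕ) + 1) • (u t : Eucl k))
  { sent := S.sent ++ (τ.observedIn t).map fun (s : Fin T) =>
      (((k : ℝ) / δ ((s : ℕ) + 1) * f s (x s)) • (u s : Eucl k), τ.dualDelay s, τ.dualBacklog s)
    pred := x }

/-- The state after the first `n` rounds. -/
noncomputable def wrapperState : ℕ → WrapperState k T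
  | 0 => ⟨[], 0⟩
  | n + 1 => if h : n < T then wrapperRound B r δ τ f u ⟨n, h⟩ (wrapperState n)
      else wrapperState n

/-- The prediction `x_t` of the wrapper, as a function of the sampled directions `u`. -/
noncomputable def wrapperPred (t : Fin T) : Eucl k := (wrapperState B r δ τ f u T).pred t

/-- The regret `∑_t (f_t(x_t) - f_t(v))` of the wrapper against `v`. -/
noncomputable def wrapperRegret (v : Eucl k) : ℝ :=
  ∑ t, (f t (wrapperPred B r δ τ f u t) - f t v)

end Wrapper

/-- The joint law of the directions `u_1, …, u_T`, independent and uniform on `S^{k-1}`. -/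
noncomputable def directionLaw (k T : ℕ) : Measure (Fin T → USphere k) :=
  Measure.pi fun _ => unifSphere k

/-! ### Parameters -/

/-- Round-dependent smoothing `δ_t = r min {1, √(νk) / t^{1/4}}`. -/
noncomputable def roundSchedule (k : ℕ) (r ν : ℝ) (t : ℕ) : ℝ :=
  r * min 1 (√(ν * k) / (t : ℝ) ^ (1 / 4 : ℝ))

/-- Fixed smoothing `δ_t = r min {1, √(νk) / T^{1/4}}`. -/
noncomputable def fixedSchedule (k T : ℕ) (r ν : ℝ) (_t : ℕ) : ℝ :=
  r * min 1 (√(ν * k) / (T : ℝ) ^ (1 / 4 : ℝ))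

/-- The learning rate
`η_n = (D/G) / √(n + ∑_{m=1}^n (σ̃*_m + (νkr/δ'_m)²))`, where `σ̃*_m` is the dual backlog of the
`m`-th observed round `ρ(m)` and `δ'_m = δ_{ρ(m) + d_{ρ(m)}}`. -/
noncomputable def learningRate {T : ℕ} (k : ℕ) (D G r ν : ℝ) (δ : ℕ → ℝ) (τ : Timeline T)
    (n : ℕ) : ℝ :=
  (D / G) / √((n : ℝ) + ∑ m ∈ Finset.univ.filter (fun m : Fin T => (m : ℕ) + 1 ≤ n),
    ((τ.dualBacklog (τ.obsOrder m) : ℝ)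
      + (ν * k * r / δ ((τ.obsOrder m : ℕ) + 1 + τ.delay (τ.obsOrder m))) ^ 2))

open Metric
open scoped NNReal Pointwise RealInnerProductSpace

/-! The one-point gradient estimate is not unbiased for a gradient of `f`, but pairing a direction
with its reflection shows that its mean is an average of chord slopes of `f`. The mean therefore has
norm at most `G` and acts as a subgradient up to a bias `O(Gδ)`, which bounds the regret by the
linear regret of P-FTRL, evaluated at the iterates in the order of observation, plus the drift of
the iterate over the latency interval `I_t`.

The direction `u_t` influences the base algorithm only once feedback `t` has been observed, so the
deviations of the estimates from their conditional means are orthogonal. Over the interval `I_t`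
they hence contribute to the drift only with the square root of their number, while the means
contribute the sum of the learning rates. Summed over `t`, these learning rates are weighted by the
dual backlogs, whose sum is `d_tot`. -/

/-! ### The uniform distribution on the sphere -/

section IsometryOfSphere

variable {E : Type*} [NormedAddCommGroup E] [NormedSpace ℝ E]

/-- The action of a linear isometry on the unit sphere. -/
def sphereHomeomorph (e : E ≃ₗᵢ[ℝ] E) : sphere (0 : E) 1 ≃ₜ sphere (0 : E) 1 :=
  e.toHomeomorph.subtype fun u => by simp

lemma coe_sphereHomeomorph (e : E ≃ₗᵢ[ℝ] E) (u : sphere (0 : E) 1) :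
    (sphereHomeomorph e u : E) = e u :=
  rfl

lemma measurePreserving_sphereHomeomorph [MeasurableSpace E] [BorelSpace E] {μ : Measure E}
    {e : E ≃ₗᵢ[ℝ] E} (he : MeasurePreserving e μ μ) :
    MeasurePreserving (sphereHomeomorph e) μ.toSphere μ.toSphere := by
  have hm := (sphereHomeomorph e).measurable
  refine ⟨hm, Measure.ext fun s hs => ?_⟩
  rw [Measure.map_apply hm hs, Measure.toSphere_apply' _ hs, Measure.toSphere_apply' _ (hm hs)]
  congr 1
  rw [← he.measure_preimage_emb e.toHomeomorph.measurableEmbedding (Set.Ioo (0 : ℝ) 1 • _ '' s)]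
  congr 1
  ext x
  simp only [Set.mem_preimage, Set.mem_smul, Set.mem_image]
  constructor
  · rintro ⟨a, ha, _, ⟨u, hu, rfl⟩, rfl⟩
    exact ⟨a, ha, _, ⟨_, hu, rfl⟩, by simp [coe_sphereHomeomorph]⟩
  · rintro ⟨a, ha, _, ⟨u, hu, rfl⟩, h⟩
    refine ⟨a, ha, _, ⟨(sphereHomeomorph e).symm u, by simpa, rfl⟩, e.injective ?_⟩
    rw [map_smul, ← coe_sphereHomeomorph, Homeomorph.apply_symm_apply, h]

end IsometryOfSphere

lemma integrable_of_continuous_of_compactSpace {X E : Type*} [TopologicalSpace X] [CompactSpace X]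
    [MeasurableSpace X] [OpensMeasurableSpace X] [NormedAddCommGroup E]
    [SecondCountableTopologyEither X E] {μ : Measure X} [IsFiniteMeasure μ] {h : X → E}
    (hh : Continuous h) : Integrable h μ :=
  hh.integrable_of_hasCompactSupport (HasCompactSupport.of_compactSpace h)

section UniformDistribution

variable {k : ℕ}

lemma integral_unifSphere_comp_sphereHomeomorph (e : Eucl k ≃ₗᵢ[ℝ] Eucl k) (h : USphere k → ℝ) :
    ∫ u, h (sphereHomeomorph e u) ∂(unifSphere k) = ∫ u, h u ∂(unifSphere k) :=
  ((measurePreserving_sphereHomeomorph e.measurePreserving).smul_measure _).integral_comp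
    (sphereHomeomorph e).measurableEmbedding h

variable [NeZero k]

instance isProbabilityMeasure_unifSphere : IsProbabilityMeasure (unifSphere k) := by
  refine ⟨ENNReal.inv_mul_cancel ?_ (measure_ne_top _ _)⟩
  rw [Ne, Measure.measure_univ_eq_zero]
  exact Measure.toSphere_ne_zero _

lemma integral_inner_sq_unifSphere (v : Eucl k) :
    ∫ u : USphere k, ⟪(u : Eucl k), v⟫ ^ 2 ∂(unifSphere k) = ‖v‖ ^ 2 / k := by
  -- A reflection maps `v` to `‖v‖ e_i`, so the squared coordinates of `‖v‖ u` have equal means.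
  have hcoord (i : Fin k) : ∫ u : USphere k, (‖v‖ * (u : Eucl k) i) ^ 2 ∂(unifSphere k)
      = ∫ u : USphere k, ⟪(u : Eucl k), v⟫ ^ 2 ∂(unifSphere k) := by
    set w : Eucl k := EuclideanSpace.single i ‖v‖ with hw
    set e := (ℝ ∙ (v - w))ᗮ.reflection
    have he : e v = w := Submodule.reflection_sub (by simp [w])
    rw [← integral_unifSphere_comp_sphereHomeomorph e]
    refine integral_congr_ae (.of_forall fun u => ?_)
    have h : ⟪e u, w⟫ = ⟪(u : Eucl k), v⟫ := by rw [← he, e.inner_map_map]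
    simpa [hw, EuclideanSpace.inner_single_right, coe_sphereHomeomorph] using congrArg (· ^ 2) h
  have hsum : ∑ i : Fin k, ∫ u : USphere k, (‖v‖ * (u : Eucl k) i) ^ 2 ∂(unifSphere k)
      = ‖v‖ ^ 2 := by
    rw [← integral_finsetSum _ fun i _ => integrable_of_continuous_of_compactSpace (by fun_prop)]
    have hnorm (u : USphere k) : ∑ i : Fin k, (‖v‖ * (u : Eucl k) i) ^ 2 = ‖v‖ ^ 2 := by
      simp_rw [mul_pow]
      rw [← Finset.mul_sum, ← EuclideanSpace.real_norm_sq_eq, norm_eq_of_mem_sphere]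
      simp
    simp [hnorm]
  simp only [hcoord, Finset.sum_const, Finset.card_univ, Fintype.card_fin, nsmul_eq_mul] at hsum
  rw [← hsum, mul_div_cancel_left₀ _ (NeZero.ne _)]

end UniformDistribution

/-! ### The single-point gradient estimate -/

section GradientEstimate

variable {k : ℕ} {K : Set (Eucl k)} {f : Eucl k → ℝ} {δ : ℝ} {G : ℝ≥0} {x y p : Eucl k}

/-- The single-point estimate of the gradient of `f` near `y` from the value of `f` at distance
`δ` in the direction `u`. -/
noncomputable def gradEst (f : Eucl k → ℝ) (δ : ℝ) (y : Eucl k) (u : USphere k) : Eucl k :=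
  ((k : ℝ) / δ * f (y + δ • (u : Eucl k))) • (u : Eucl k)

/-- The mean of the single-point gradient estimate over a uniformly distributed direction. -/
noncomputable def meanGrad (f : Eucl k → ℝ) (δ : ℝ) (y : Eucl k) : Eucl k :=
  ∫ u, gradEst f δ y u ∂(unifSphere k)

lemma add_smul_sphere_mem_closedBall (hδ : 0 ≤ δ) (y : Eucl k) (u : USphere k) :
    y + δ • (u : Eucl k) ∈ closedBall y δ := by
  simp [norm_smul, abs_of_nonneg hδ]

lemma norm_gradEst_le {M : ℝ} (hδ : 0 < δ) (hM : ∀ x ∈ closedBall y δ, |f x| ≤ M)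
    (u : USphere k) : ‖gradEst f δ y u‖ ≤ k * M / δ := by
  rw [gradEst, norm_smul, norm_mul, Real.norm_eq_abs, Real.norm_eq_abs,
    abs_of_nonneg (by positivity), norm_eq_of_mem_sphere, mul_one, div_mul_eq_mul_div]
  gcongr
  exact hM _ (add_smul_sphere_mem_closedBall hδ.le y u)

lemma continuous_sphere_eval (hδ : 0 ≤ δ) (hf : ContinuousOn f (closedBall y δ)) :
    Continuous fun u : USphere k => f (y + δ • (u : Eucl k)) :=
  hf.comp_continuous (by fun_prop) (add_smul_sphere_mem_closedBall hδ y)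

lemma eq_reflection_add_smul (u p : Eucl k) :
    u = (ℝ ∙ p)ᗮ.reflection u + (2 * ⟪u, p⟫ / ‖p‖ ^ 2) • p := by
  rw [Submodule.reflection_orthogonal_apply, Submodule.reflection_singleton_apply,
    real_inner_comm]
  simp only [RCLike.ofReal_real_eq_id, id]
  module

lemma inner_meanGrad_eq [NeZero k] (hδ : 0 ≤ δ) (hf : ContinuousOn f (closedBall y δ)) :
    ⟪meanGrad f δ y, p⟫ = k / (2 * δ) * ∫ u : USphere k,
      (f (y + δ • (u : Eucl k)) - f (y + δ • (ℝ ∙ p)ᗮ.reflection (u : Eucl k)))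
        * ⟪(u : Eucl k), p⟫ ∂(unifSphere k) := by
  set e := (ℝ ∙ p)ᗮ.reflection
  set F : USphere k → ℝ := fun u => f (y + δ • (u : Eucl k)) * ⟪(u : Eucl k), p⟫
  have hcont : Continuous F := (continuous_sphere_eval hδ hf).mul (by fun_prop)
  have hflip (u : USphere k) : f (y + δ • e (u : Eucl k)) * ⟪(u : Eucl k), p⟫
      = -F (sphereHomeomorph e u) := by
    have h := e.inner_map_map (u : Eucl k) p
    rw [Submodule.reflection_orthogonalComplement_singleton_eq_neg, inner_neg_right] at h
    simp only [F, coe_sphereHomeomorph]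
    rw [← h]
    ring
  have hmean : ⟪meanGrad f δ y, p⟫ = k / δ * ∫ u, F u ∂(unifSphere k) := by
    have hint : Integrable (gradEst f δ y) (unifSphere k) :=
      integrable_of_continuous_of_compactSpace <|
        (continuous_const.mul (continuous_sphere_eval hδ hf)).smul continuous_subtype_val
    rw [meanGrad, real_inner_comm, ← integral_inner hint, ← integral_const_mul]
    congr 1 with u
    rw [gradEst, real_inner_comm, real_inner_smul_left]
    ring
  have hint : Integrable F (unifSphere k) := integrable_of_continuous_of_compactSpace hcont
  have hint' : Integrable (fun u => F (sphereHomeomorph e u)) (unifSphere k) :=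
    integrable_of_continuous_of_compactSpace (hcont.comp (sphereHomeomorph e).continuous)
  simp_rw [sub_mul, hflip, sub_neg_eq_add]
  rw [integral_add hint hint', integral_unifSphere_comp_sphereHomeomorph, hmean]
  ring

lemma chord_increment_mul_inner_le {V : ℝ} (hδ : 0 ≤ δ)
    (hV : ∀ w ∈ closedBall y δ, ∀ θ : ℝ, 0 ≤ θ → w + θ • p ∈ closedBall y δ →
      f (w + θ • p) - f w ≤ θ * V) (u : USphere k) :
    (f (y + δ • (u : Eucl k)) - f (y + δ • (ℝ ∙ p)ᗮ.reflection (u : Eucl k))) * ⟪(u : Eucl k), p⟫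
      ≤ 2 * δ * V / ‖p‖ ^ 2 * ⟪(u : Eucl k), p⟫ ^ 2 := by
  set e := (ℝ ∙ p)ᗮ.reflection
  set a := ⟪(u : Eucl k), p⟫
  have hu := add_smul_sphere_mem_closedBall hδ y u
  have heu := add_smul_sphere_mem_closedBall hδ y (sphereHomeomorph e u)
  rw [coe_sphereHomeomorph] at heu
  have hend : y + δ • (u : Eucl k) = y + δ • e (u : Eucl k) + (2 * δ * a / ‖p‖ ^ 2) • p := by
    conv_lhs => rw [eq_reflection_add_smul (u : Eucl k) p]
    module
  have hstart : y + δ • (u : Eucl k) + (2 * δ * -a / ‖p‖ ^ 2) • p = y + δ • e (u : Eucl k) := by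
    rw [hend]
    module
  have hrhs : 2 * δ * V / ‖p‖ ^ 2 * a ^ 2 = 2 * δ * a / ‖p‖ ^ 2 * V * a := by ring
  rw [hrhs]
  rcases le_total 0 a with ha | ha
  · have h := hV _ heu (2 * δ * a / ‖p‖ ^ 2) (by positivity)
    rw [← hend] at h
    exact mul_le_mul_of_nonneg_right (h hu) ha
  · have h := hV _ hu (2 * δ * -a / ‖p‖ ^ 2)
      (div_nonneg (mul_nonneg (by positivity) (neg_nonneg.2 ha)) (by positivity))
    rw [hstart] at h
    refine mul_le_mul_of_nonpos_right ?_ ha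
    linear_combination h heu

-- The reflection across `pᗮ` pairs the points of the sphere around `y` into the endpoints of
-- chords parallel to `p`; the mean gradient averages the slopes of `f` along these chords.
lemma inner_meanGrad_le_of_chord_slope_le [NeZero k] {V : ℝ} (hδ : 0 < δ)
    (hf : ContinuousOn f (closedBall y δ))
    (hV : ∀ w ∈ closedBall y δ, ∀ θ : ℝ, 0 ≤ θ → w + θ • p ∈ closedBall y δ →
      f (w + θ • p) - f w ≤ θ * V) :
    ⟪meanGrad f δ y, p⟫ ≤ V := by
  rcases eq_or_ne p 0 with rfl | hp
  · simpa [hδ.le] using hV y (mem_closedBall_self hδ.le) 1 zero_le_one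
  have hfu := continuous_sphere_eval hδ.le hf
  have hfe := hfu.comp (sphereHomeomorph (ℝ ∙ p)ᗮ.reflection).continuous
  calc ⟪meanGrad f δ y, p⟫
      ≤ k / (2 * δ) * ∫ u : USphere k, 2 * δ * V / ‖p‖ ^ 2 * ⟪(u : Eucl k), p⟫ ^ 2
          ∂(unifSphere k) := by
        rw [inner_meanGrad_eq hδ.le hf]
        refine mul_le_mul_of_nonneg_left (integral_mono
          (integrable_of_continuous_of_compactSpace ((hfu.sub hfe).mul (by fun_prop)))
          (integrable_of_continuous_of_compactSpace (by fun_prop))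
          (chord_increment_mul_inner_le hδ.le hV)) (by positivity)
    _ = V := by
        have : (k : ℝ) ≠ 0 := NeZero.ne _
        rw [integral_const_mul, integral_inner_sq_unifSphere]
        field_simp [norm_ne_zero_iff.2 hp]

variable [NeZero k]

lemma inner_meanGrad_le_mul_norm (hδ : 0 < δ) (hL : LipschitzOnWith G f (closedBall y δ)) :
    ⟪meanGrad f δ y, p⟫ ≤ G * ‖p‖ := by
  refine inner_meanGrad_le_of_chord_slope_le hδ hL.continuousOn fun w hw θ hθ hwθ => ?_
  have h := (le_abs_self _).trans (hL.norm_sub_le hwθ hw)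
  rw [add_sub_cancel_left, norm_smul, Real.norm_of_nonneg hθ] at h
  linarith

lemma norm_meanGrad_le (hδ : 0 < δ) (hL : LipschitzOnWith G f (closedBall y δ)) :
    ‖meanGrad f δ y‖ ≤ G := by
  have h := inner_meanGrad_le_mul_norm (p := meanGrad f δ y) hδ hL
  rw [real_inner_self_eq_norm_sq] at h
  by_contra! hlt
  nlinarith [norm_nonneg (meanGrad f δ y), G.coe_nonneg]

lemma inner_meanGrad_sub_le (hδ : 0 < δ) (hf : ConvexOn ℝ K f) (hL : LipschitzOnWith G f K)
    (hy : closedBall y δ ⊆ K) (hx : closedBall x δ ⊆ K) :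
    ⟪meanGrad f δ y, x - y⟫ ≤ f x - f y + 4 * G * δ := by
  have hyK := hy (mem_closedBall_self hδ.le)
  have hxK := hx (mem_closedBall_self hδ.le)
  rcases lt_or_ge ‖x - y‖ (2 * δ) with hnear | hfar
  · have hgrad := inner_meanGrad_le_mul_norm (p := x - y) hδ (hL.mono hy)
    have hvalue := (abs_le.1 (hL.norm_sub_le hxK hyK)).1
    nlinarith [G.coe_nonneg]
  have hslope : ⟪meanGrad f δ y, x - y⟫ ≤ f x - f y + 2 * G * δ := by
    refine inner_meanGrad_le_of_chord_slope_le hδ (hL.mono hy).continuousOn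
      fun w hw θ hθ hwθ => ?_
    have hθ1 : θ ≤ 1 := by
      have h := dist_triangle_right (w + θ • (x - y)) w y
      rw [dist_eq_norm, add_sub_cancel_left, norm_smul, Real.norm_of_nonneg hθ] at h
      by_contra! hgt
      nlinarith [mem_closedBall.1 hw, mem_closedBall.1 hwθ]
    have hdist : w + (x - y) - x = w - y := by abel
    have hwx : w + (x - y) ∈ closedBall x δ := by
      rw [mem_closedBall, dist_eq_norm, hdist, ← dist_eq_norm]; exact hw
    have hconv := hf.2 (hy hw) (hx hwx) (sub_nonneg.2 hθ1) hθ (by ring)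
    rw [show (1 - θ) • w + θ • (w + (x - y)) = w + θ • (x - y) by module] at hconv
    have hwy : ‖w - y‖ ≤ δ := by rw [← dist_eq_norm]; exact hw
    have hend := (abs_le.1 (hL.norm_sub_le (hx hwx) hxK)).2
    have hstart := (abs_le.1 (hL.norm_sub_le (hy hw) hyK)).1
    rw [hdist] at hend
    simp only [smul_eq_mul] at hconv
    have hscale : G * ‖w - y‖ ≤ G * δ := by gcongr
    nlinarith
  nlinarith [G.coe_nonneg]

end GradientEstimate

/-! ### Proximal follow-the-regularized-leader -/

section ProximalFTRL

variable {E : Type*} [NormedAddCommGroup E] [InnerProductSpace ℝ E] {K : Set E} {c : ℕ → E}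
  {β : ℕ → ℝ} {z : ℕ → E} {x : E} {n m : ℕ}

/-- The objective minimized by P-FTRL after the loss vectors `c 0, …, c (n - 1)`, where `β m` is
the weight of the proximal term centered at `z m`. -/
noncomputable def ftrlObjective (c : ℕ → E) (β : ℕ → ℝ) (z : ℕ → E) (n : ℕ) (x : E) : ℝ :=
  ∑ m ∈ Finset.range n, (⟪c m, x⟫ + β m * ‖z m - x‖ ^ 2 / 2)

/-- The gradient of `ftrlObjective` at `x`. -/
noncomputable def ftrlGradient (c : ℕ → E) (β : ℕ → ℝ) (z : ℕ → E) (n : ℕ) (x : E) : E :=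
  ∑ m ∈ Finset.range n, (c m + β m • (x - z m))

/-- The iterates `z` satisfy the first-order optimality conditions of P-FTRL on `K`. Unlike
minimality, these conditions are all that the regret and stability bounds use. -/
structure IsProximalFTRL (K : Set E) (c : ℕ → E) (β : ℕ → ℝ) (z : ℕ → E) : Prop where
  mem : ∀ n, z n ∈ K
  inner_nonneg : ∀ n, ∀ w ∈ K, 0 ≤ ⟪ftrlGradient c β z n (z n), w - z n⟫

lemma ftrlGradient_eq_sum_sub_add_smul (c : ℕ → E) (β : ℕ → ℝ) (z : ℕ → E) (n : ℕ) (x : E) :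
    ftrlGradient c β z n x
      = ∑ m ∈ Finset.range n, (c m - β m • z m) + (∑ m ∈ Finset.range n, β m) • x := by
  rw [ftrlGradient, Finset.sum_smul, ← Finset.sum_add_distrib]
  refine Finset.sum_congr rfl fun m _ => ?_
  module

lemma ftrlObjective_sub (c : ℕ → E) (β : ℕ → ℝ) (z : ℕ → E) (n : ℕ) (x w : E) :
    ftrlObjective c β z n w - ftrlObjective c β z n x
      = ⟪ftrlGradient c β z n x, w - x⟫ + (∑ m ∈ Finset.range n, β m) * ‖w - x‖ ^ 2 / 2 := by
  rw [ftrlObjective, ftrlObjective, ftrlGradient, ← Finset.sum_sub_distrib, sum_inner,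
    Finset.sum_mul, Finset.sum_div, ← Finset.sum_add_distrib]
  refine Finset.sum_congr rfl fun m _ => ?_
  have h : ‖z m - w‖ ^ 2 = ‖z m - x‖ ^ 2 + 2 * ⟪x - z m, w - x⟫ + ‖w - x‖ ^ 2 := by
    rw [norm_sub_rev, norm_sub_rev (z m), ← norm_add_sq_real, add_comm, sub_add_sub_cancel]
  rw [h, inner_add_left, real_inner_smul_left, inner_sub_right (c m)]
  ring

lemma hasFDerivAt_ftrlObjective (c : ℕ → E) (β : ℕ → ℝ) (z : ℕ → E) (n : ℕ) (x : E) :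
    HasFDerivAt (ftrlObjective c β z n) (innerSL ℝ (ftrlGradient c β z n x)) x := by
  rw [ftrlGradient, map_sum]
  refine HasFDerivAt.fun_sum fun m _ => ?_
  have h := (innerSL ℝ (c m)).hasFDerivAt.add
    (((hasFDerivAt_id x).const_sub (z m)).norm_sq.const_mul (β m / 2))
  convert h using 1
  · ext y
    simp [mul_div_right_comm]
  · ext y
    simp
    ring

lemma inner_ftrlGradient_nonneg_of_isMinOn {w : E} (hK : Convex ℝ K) (hx : x ∈ K) (hw : w ∈ K)
    (hmin : IsMinOn (ftrlObjective c β z n) K x) : 0 ≤ ⟪ftrlGradient c β z n x, w - x⟫ :=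
  hmin.localize.hasFDerivWithinAt_nonneg
    (hasFDerivAt_ftrlObjective c β z n x).hasFDerivWithinAt
    (sub_mem_posTangentConeAt_of_segment_subset (hK.segment_subset hx hw))

lemma mul_norm_sub_le_of_inner_nonneg {A : ℝ} {p q w : E} (hx : 0 ≤ ⟪p + A • x, w - x⟫)
    (hw : 0 ≤ ⟪q + A • w, x - w⟫) : A * ‖x - w‖ ≤ ‖p - q‖ := by
  rcases eq_or_ne x w with rfl | hne
  · simp
  refine le_of_mul_le_mul_right ?_ (norm_pos_iff.2 (sub_ne_zero.2 hne))
  calc A * ‖x - w‖ * ‖x - w‖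
      = -⟪p - q, x - w⟫ - (⟪p + A • x, w - x⟫ + ⟪q + A • w, x - w⟫) := by
        rw [mul_assoc, ← real_inner_self_eq_norm_mul_norm, ← neg_sub x w]
        simp only [inner_neg_right, inner_add_left, inner_sub_left, real_inner_smul_left]
        ring
    _ ≤ -⟪p - q, x - w⟫ := by linarith
    _ ≤ ‖p - q‖ * ‖x - w‖ := (neg_le_abs _).trans (abs_real_inner_le_norm _ _)

namespace IsProximalFTRL

lemma ftrlObjective_add_le (h : IsProximalFTRL K c β z) (n : ℕ) (hx : x ∈ K) :
    ftrlObjective c β z n (z n) + (∑ m ∈ Finset.range n, β m) * ‖x - z n‖ ^ 2 / 2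
      ≤ ftrlObjective c β z n x := by
  linarith [ftrlObjective_sub c β z n (z n) x, h.inner_nonneg n x hx]

lemma ftrlObjective_succ_ge (h : IsProximalFTRL K c β z)
    (hpos : 0 < ∑ m ∈ Finset.range (n + 1), β m) :
    ftrlObjective c β z n (z n)
        + (⟪c n, z n⟫ - ‖c n‖ ^ 2 / (2 * ∑ m ∈ Finset.range (n + 1), β m))
      ≤ ftrlObjective c β z (n + 1) (z (n + 1)) := by
  have hmin := h.ftrlObjective_add_le n (h.mem (n + 1))
  have hstep : ftrlObjective c β z (n + 1) (z (n + 1)) = ftrlObjective c β z n (z (n + 1))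
      + (⟪c n, z (n + 1)⟫ + β n * ‖z (n + 1) - z n‖ ^ 2 / 2) := by
    rw [ftrlObjective, Finset.sum_range_succ, norm_sub_rev (z n), ftrlObjective]
  have hinner : -⟪c n, z (n + 1) - z n⟫ ≤ ‖c n‖ * ‖z (n + 1) - z n‖ :=
    (neg_le_abs _).trans (abs_real_inner_le_norm _ _)
  rw [inner_sub_right] at hinner
  have hsum := Finset.sum_range_succ β n
  set A := ∑ m ∈ Finset.range (n + 1), β m
  set d := ‖z (n + 1) - z n‖
  have hyoung : 0 ≤ ‖c n‖ ^ 2 / (2 * A) + A * d ^ 2 / 2 - ‖c n‖ * d := by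
    have : ‖c n‖ ^ 2 / (2 * A) + A * d ^ 2 / 2 - ‖c n‖ * d = (‖c n‖ - A * d) ^ 2 / (2 * A) := by
      field_simp
      ring
    rw [this]
    positivity
  rw [hsum] at hyoung ⊢
  linarith

lemma regret_le (h : IsProximalFTRL K c β z) (N : ℕ)
    (hpos : ∀ n < N, 0 < ∑ m ∈ Finset.range (n + 1), β m) (hx : x ∈ K) :
    ∑ n ∈ Finset.range N, ⟪c n, z n - x⟫
      ≤ ∑ n ∈ Finset.range N, β n * ‖z n - x‖ ^ 2 / 2
        + ∑ n ∈ Finset.range N, ‖c n‖ ^ 2 / (2 * ∑ m ∈ Finset.range (n + 1), β m) := by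
  have hlow : ∀ n ≤ N, ∑ m ∈ Finset.range n,
      (⟪c m, z m⟫ - ‖c m‖ ^ 2 / (2 * ∑ j ∈ Finset.range (m + 1), β j))
        ≤ ftrlObjective c β z n (z n) := by
    intro n hn
    induction n with
    | zero => simp [ftrlObjective]
    | succ n ih =>
      rw [Finset.sum_range_succ]
      linarith [ih (by lia), h.ftrlObjective_succ_ge (hpos n hn)]
  have hhigh : ftrlObjective c β z N (z N) ≤ ftrlObjective c β z N x := by
    have hweight : 0 ≤ ∑ m ∈ Finset.range N, β m := by
      cases N with
      | zero => simp
      | succ N => exact (hpos N N.lt_succ_self).le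
    have := h.ftrlObjective_add_le N hx
    nlinarith [sq_nonneg ‖x - z N‖]
  have h := (hlow N le_rfl).trans hhigh
  rw [ftrlObjective, Finset.sum_add_distrib, Finset.sum_sub_distrib] at h
  simp_rw [inner_sub_right]
  rw [Finset.sum_sub_distrib]
  linarith

lemma mul_norm_sub_le (h : IsProximalFTRL K c β z) (hβ : ∀ n, 0 ≤ β n) (hnm : n ≤ m) :
    (∑ j ∈ Finset.range m, β j) * ‖z m - z n‖
      ≤ ‖∑ j ∈ Finset.Ico n m, c j‖ + ∑ j ∈ Finset.Ico n m, β j * ‖z j - z n‖ := by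
  set A := ∑ j ∈ Finset.range m, β j
  have hm := h.inner_nonneg m _ (h.mem n)
  have hn := h.inner_nonneg n _ (h.mem m)
  rw [ftrlGradient_eq_sum_sub_add_smul] at hm
  rw [← sub_add_cancel (ftrlGradient c β z n (z n)) (A • z n)] at hn
  refine (mul_norm_sub_le_of_inner_nonneg hm hn).trans ?_
  have hdiff : ∑ j ∈ Finset.range m, (c j - β j • z j)
      - (ftrlGradient c β z n (z n) - A • z n)
      = ∑ j ∈ Finset.Ico n m, c j + ∑ j ∈ Finset.Ico n m, β j • (z n - z j) := by
    have hsplit := ftrlGradient_eq_sum_sub_add_smul c β z m (z n)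
    rw [ftrlGradient, ← Finset.sum_range_add_sum_Ico _ hnm,
      Finset.sum_add_distrib (s := Finset.Ico n m)] at hsplit
    rw [sub_sub_eq_add_sub, ← hsplit, ftrlGradient, add_sub_cancel_left]
  rw [hdiff]
  refine (norm_add_le _ _).trans ?_
  gcongr
  refine (norm_sum_le _ _).trans (Finset.sum_le_sum fun j _ => ?_)
  rw [norm_smul, Real.norm_of_nonneg (hβ j), norm_sub_rev]

end IsProximalFTRL

end ProximalFTRL

section DriftRecursion

variable {β W : ℕ → ℝ} {a b : ℝ} {n m N : ℕ}

/-- The solution `U` of the recursion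
`(β_0 + ⋯ + β_{m-1}) U_m = a + b (m - n) + ∑_{n < j < m} β_j U_j` for `m > n`. -/
noncomputable def driftBound (β : ℕ → ℝ) (a b : ℝ) (n m : ℕ) : ℝ :=
  a / ∑ i ∈ Finset.range (n + 1), β i + ∑ j ∈ Finset.Ico n m, b / ∑ i ∈ Finset.range (j + 1), β i

lemma mul_driftBound (hpos : ∀ j, n ≤ j → 0 < ∑ i ∈ Finset.range (j + 1), β i) (hnm : n < m) :
    (∑ i ∈ Finset.range m, β i) * driftBound β a b n m
      = a + b * (m - n : ℝ) + ∑ j ∈ Finset.Ico (n + 1) m, β j * driftBound β a b n j := by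
  induction m, hnm using Nat.le_induction with
  | base =>
    simp only [driftBound, Nat.Ico_succ_singleton, Finset.sum_singleton, Finset.Ico_self,
      Finset.sum_empty]
    rw [← add_div, mul_div_cancel₀ _ (hpos n le_rfl).ne']
    push_cast
    ring
  | succ m hnm ih =>
    have hstep : driftBound β a b n (m + 1)
        = driftBound β a b n m + b / ∑ i ∈ Finset.range (m + 1), β i := by
      rw [driftBound, Finset.sum_Ico_succ_top (by lia), ← add_assoc, driftBound]
    rw [hstep, mul_add, mul_div_cancel₀ _ (hpos m (by lia)).ne', Finset.sum_range_succ, add_mul,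
      ih, Finset.sum_Ico_succ_top hnm]
    push_cast
    ring

lemma le_driftBound_of_recursion (hβ : ∀ j, 0 ≤ β j) (ha : 0 ≤ a) (hb : 0 ≤ b)
    (hpos : ∀ j, n ≤ j → 0 < ∑ i ∈ Finset.range (j + 1), β i) (hW : W n = 0)
    (hrec : ∀ m, n < m → m ≤ N → (∑ j ∈ Finset.range m, β j) * W m
      ≤ a + b * (m - n : ℝ) + ∑ j ∈ Finset.Ico n m, β j * W j)
    (hnm : n ≤ m) (hmN : m ≤ N) : W m ≤ driftBound β a b n m := by
  induction m using Nat.strong_induction_on with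
  | _ m ih =>
    rcases hnm.eq_or_lt with rfl | hlt
    · rw [hW]
      exact add_nonneg (div_nonneg ha (hpos n le_rfl).le)
        (Finset.sum_nonneg fun j hj => div_nonneg hb (hpos j (Finset.mem_Ico.1 hj).1).le)
    have hA : 0 < ∑ j ∈ Finset.range m, β j := by
      simpa [Nat.sub_add_cancel (Nat.one_le_of_lt hlt)] using hpos (m - 1) (by lia)
    refine le_of_mul_le_mul_left ((hrec m hlt hmN).trans ?_) hA
    rw [mul_driftBound hpos hlt, Finset.sum_eq_sum_Ico_succ_bot hlt, hW, mul_zero, zero_add]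
    gcongr with j hj
    · exact hβ j
    · have hj' := Finset.mem_Ico.1 hj
      exact ih j hj'.2 (by lia) (by lia)

end DriftRecursion

section PFTRL

variable {k : ℕ} {K : Set (Eucl k)} {z₁ : Eucl k} {η : ℕ → ℝ}

lemma argminOn_spec {φ : Eucl k → ℝ} (h : ∃ z ∈ K, IsMinOn φ K z) :
    argminOn K φ ∈ K ∧ IsMinOn φ K (argminOn K φ) :=
  Classical.epsilon_spec h

/-- The weight `α_{m+1}` of the proximal term of P-FTRL that is centered at `z_{m+1}`, the iterate
with index `m` in `pftrlIterate`. -/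
noncomputable def stepWeight (η : ℕ → ℝ) (m : ℕ) : ℝ := pftrlWeight η (m + 1)

lemma sum_stepWeight (η : ℕ → ℝ) (n : ℕ) :
    ∑ m ∈ Finset.range (n + 1), stepWeight η m = 1 / η (n + 1) := by
  induction n with
  | zero => simp [stepWeight, pftrlWeight]
  | succ n ih => rw [Finset.sum_range_succ, ih, stepWeight, pftrlWeight, add_sub_cancel]

lemma pftrlIterate_succ (K : Set (Eucl k)) (z₁ : Eucl k) (η : ℕ → ℝ) (c : ℕ → Eucl k) (n : ℕ) :
    pftrlIterate K z₁ η c (n + 1)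
      = argminOn K (ftrlObjective c (stepWeight η) (pftrlIterate K z₁ η c) (n + 1)) := by
  rw [pftrlIterate]
  congr 1 with z
  rw [ftrlObjective, ← Fin.sum_univ_eq_sum_range
    (fun m => ⟪c m, z⟫ + stepWeight η m * ‖pftrlIterate K z₁ η c m - z‖ ^ 2 / 2)]
  rfl

lemma isProximalFTRL_pftrlIterate (hK : IsCompact K) (hconv : Convex ℝ K) (hz₁ : z₁ ∈ K)
    (η : ℕ → ℝ) (c : ℕ → Eucl k) :
    IsProximalFTRL K c (stepWeight η) (pftrlIterate K z₁ η c) := by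
  have hmin (n : ℕ) := argminOn_spec <| hK.exists_isMinOn ⟨z₁, hz₁⟩ fun x _ =>
    (hasFDerivAt_ftrlObjective c (stepWeight η) (pftrlIterate K z₁ η c)
      (n + 1) x).continuousAt.continuousWithinAt
  simp only [← pftrlIterate_succ] at hmin
  constructor
  · rintro (_ | n)
    · rwa [pftrlIterate]
    · exact (hmin n).1
  · rintro (_ | n) w hw
    · simp [ftrlGradient]
    · exact inner_ftrlGradient_nonneg_of_isMinOn hconv (hmin n).1 hw (hmin n).2

lemma pftrlIterate_congr (K : Set (Eucl k)) (z₁ : Eucl k) (η : ℕ → ℝ) {c c' : ℕ → Eucl k} {n : ℕ}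
    (h : ∀ m < n, c m = c' m) : pftrlIterate K z₁ η c n = pftrlIterate K z₁ η c' n := by
  induction n using Nat.strong_induction_on with
  | _ n ih =>
    cases n with
    | zero => rw [pftrlIterate, pftrlIterate]
    | succ n =>
      rw [pftrlIterate_succ, pftrlIterate_succ]
      congr 1 with z
      refine Finset.sum_congr rfl fun m hm => ?_
      have hm' := Finset.mem_range.1 hm
      rw [h m hm', ih m hm' fun j hj => h j (hj.trans hm')]

-- The minimizer of a strongly convex objective is a Lipschitz function of its linear part.
lemma continuous_pftrlIterate {X : Type*} [TopologicalSpace X] (hK : IsCompact K)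
    (hconv : Convex ℝ K) (hz₁ : z₁ ∈ K) (hη : ∀ n, 0 < η (n + 1)) {c : X → ℕ → Eucl k} {n : ℕ}
    (hc : ∀ m < n, Continuous fun x => c x m) :
    Continuous fun x => pftrlIterate K z₁ η (c x) n := by
  induction n using Nat.strong_induction_on with
  | _ n ih =>
    cases n with
    | zero =>
      simp only [pftrlIterate]
      exact continuous_const
    | succ n =>
      set z := fun x => pftrlIterate K z₁ η (c x)
      set p : X → Eucl k := fun x =>
        ∑ m ∈ Finset.range (n + 1), (c x m - stepWeight η m • z x m)
      have hp : Continuous p := continuous_finsetSum _ fun m hm => by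
        have hm' := Finset.mem_range.1 hm
        have hz : Continuous fun x => z x m := ih m hm' fun j hj => hc j (hj.trans hm')
        have hsz : Continuous fun x => stepWeight η m • z x m := by fun_prop
        exact (hc m hm').sub hsz
      have hopt (x y : X) :
          0 ≤ ⟪p x + (1 / η (n + 1)) • z x (n + 1), z y (n + 1) - z x (n + 1)⟫ := by
        have hx := isProximalFTRL_pftrlIterate hK hconv hz₁ η (c x)
        have hy := isProximalFTRL_pftrlIterate hK hconv hz₁ η (c y)
        rw [← sum_stepWeight, ← ftrlGradient_eq_sum_sub_add_smul]
        exact hx.inner_nonneg (n + 1) _ (hy.mem (n + 1))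
      have hlip (x y : X) : dist (z y (n + 1)) (z x (n + 1)) ≤ η (n + 1) * dist (p y) (p x) := by
        have h := mul_norm_sub_le_of_inner_nonneg (hopt y x) (hopt x y)
        rwa [one_div, inv_mul_le_iff₀ (hη n), ← dist_eq_norm, ← dist_eq_norm] at h
      refine continuous_iff_continuousAt.2 fun x => tendsto_iff_dist_tendsto_zero.2 <|
        squeeze_zero (fun _ => dist_nonneg) (fun y => hlip x y) ?_
      simpa using (tendsto_iff_dist_tendsto_zero.1 hp.continuousAt).const_mul (η (n + 1))

end PFTRL

/-! ### Combinatorics of the timeline -/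

section LowerSets

variable {T : ℕ}

lemma lt_card_filter_iff {P : Fin T → Prop} [DecidablePred P] (hP : ∀ i j, i ≤ j → P j → P i)
    (m : Fin T) : (m : ℕ) < (Finset.univ.filter P).card ↔ P m := by
  refine ⟨fun h => ?_, fun h => ?_⟩
  · by_contra hm
    have hsub : Finset.univ.filter P ⊆ Finset.Iio m := fun j hj =>
      Finset.mem_Iio.2 <| lt_of_not_ge fun hle => hm (hP m j hle (Finset.mem_filter.1 hj).2)
    have hcard := Finset.card_le_card hsub
    rw [Fin.card_Iio] at hcard
    exact h.not_ge hcard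
  · have hsub : Finset.Iic m ⊆ Finset.univ.filter P := fun j hj =>
      Finset.mem_filter.2 ⟨Finset.mem_univ _, hP j m (Finset.mem_Iic.1 hj) h⟩
    have hcard := Finset.card_le_card hsub
    rwa [Fin.card_Iic] at hcard

lemma filter_lt_finRange (n : ℕ) :
    (List.finRange T).filter (fun m : Fin T => (m : ℕ) < n) = (List.finRange T).take n := by
  conv_lhs => rw [← List.take_append_drop n (List.finRange T), List.filter_append]
  rw [List.filter_eq_self.2, List.filter_eq_nil_iff.2, List.append_nil]
  · intro a ha
    obtain ⟨i, hi, rfl⟩ := List.mem_drop_iff_getElem.1 ha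
    simp
  · intro a ha
    obtain ⟨i, hi, rfl⟩ := List.mem_take_iff_getElem.1 ha
    simp only [List.length_finRange, lt_inf_iff] at hi
    simpa using hi.1

lemma filter_lt_append_filter_eq {α : Type*} (g : α → ℕ) (n : ℕ) {L : List α}
    (hL : L.Pairwise fun a b => g a ≤ g b) :
    L.filter (fun a => g a < n) ++ L.filter (fun a => g a = n)
      = L.filter (fun a => g a < n + 1) := by
  induction L with
  | nil => simp
  | cons a L ih =>
    rw [List.pairwise_cons] at hL
    have ih := ih hL.2
    rcases lt_trichotomy (g a) n with h | h | h
    · rw [List.filter_cons_of_pos (by simpa using h), List.filter_cons_of_neg (by simpa using h.ne),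
        List.filter_cons_of_pos (by simpa using h.le), List.cons_append, ih]
    · have hnil : L.filter (fun a => g a < n) = [] :=
        List.filter_eq_nil_iff.2 fun b hb => by simpa [← h] using hL.1 b hb
      rw [hnil, List.nil_append] at ih
      simp [h, hnil, ih]
    · rw [List.filter_cons_of_neg (by simpa using h.le),
        List.filter_cons_of_neg (by simpa using h.ne'),
        List.filter_cons_of_neg (by simpa using h), ih]

end LowerSets

namespace Timeline

variable {T : ℕ} (τ : Timeline T)

lemma strictMono_r_obsOrder : StrictMono (τ.r ∘ τ.obsOrder) :=
  (Tuple.monotone_sort τ.r).strictMono_of_injective (τ.r_injective.comp τ.obsOrder.injective)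

/-- The position of the feedback of round `t` in the order of observation, counting from `0`. -/
noncomputable def obsPos (t : Fin T) : Fin T := τ.obsOrder.symm t

@[simp] lemma obsOrder_obsPos (t : Fin T) : τ.obsOrder (τ.obsPos t) = t :=
  τ.obsOrder.apply_symm_apply t

@[simp] lemma obsPos_obsOrder (m : Fin T) : τ.obsPos (τ.obsOrder m) = m :=
  τ.obsOrder.symm_apply_apply m

lemma obsPos_injective : Function.Injective τ.obsPos := τ.obsOrder.symm.injective

lemma obsPos_lt_iff {s t : Fin T} : τ.obsPos s < τ.obsPos t ↔ τ.r s < τ.r t := by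
  simpa using (τ.strictMono_r_obsOrder.lt_iff_lt (a := τ.obsPos s) (b := τ.obsPos t)).symm

open Classical in
/-- The number of observations received before time `x`. -/
noncomputable def obsCount (x : ℝ) : ℕ :=
  (Finset.univ.filter fun s => τ.r s < x).card

lemma lt_obsCount_iff {x : ℝ} {m : Fin T} :
    (m : ℕ) < τ.obsCount x ↔ τ.r (τ.obsOrder m) < x := by
  classical
  have hcard : τ.obsCount x = (Finset.univ.filter fun m => τ.r (τ.obsOrder m) < x).card :=
    Finset.card_equiv τ.obsOrder.symm (by simp)
  rw [hcard]
  exact lt_card_filter_iff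
    (fun _ _ hij hj => (τ.strictMono_r_obsOrder.monotone hij).trans_lt hj) m

lemma obsCount_le (x : ℝ) : τ.obsCount x ≤ T :=
  (Finset.card_filter_le _ _).trans_eq (Finset.card_fin T)

lemma obsPos_eq_obsCount (t : Fin T) : (τ.obsPos t : ℕ) = τ.obsCount (τ.r t) := by
  rw [← Fin.card_Iio]
  exact Finset.card_equiv τ.obsOrder fun m => by simp [← τ.obsPos_lt_iff]

/-- The number of observations received before the prediction of round `t`. -/
noncomputable def seen (t : Fin T) : ℕ := τ.obsCount (τ.l t)

lemma seen_le_obsPos (t : Fin T) : τ.seen t ≤ τ.obsPos t := by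
  rw [obsPos_eq_obsCount, seen, obsCount, obsCount]
  exact Finset.card_le_card <|
    Finset.monotone_filter_right _ fun s _ (hs : τ.r s < τ.l t) => hs.trans (τ.l_lt_r t)

lemma seen_le (t : Fin T) : τ.seen t ≤ t := by
  rw [← Fin.card_Iio t, seen, obsCount]
  exact Finset.card_le_card fun s hs => Finset.mem_Iio.2 <|
    τ.l_strictMono.lt_iff_lt.1 ((τ.l_lt_r s).trans (Finset.mem_filter.1 hs).2)

lemma card_l_lt_r (s : Fin T) :
    (Finset.univ.filter fun t => τ.l t < τ.r s).card = (s : ℕ) + 1 + τ.delay s := by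
  classical
  have hdisj : Disjoint (Finset.Iic s) (Finset.univ.filter fun t => τ.l t ∈ τ.interval s) :=
    Finset.disjoint_left.2 fun t h₁ h₂ =>
      (Finset.mem_Iic.1 h₁).not_gt (τ.l_strictMono.lt_iff_lt.1 (Finset.mem_filter.1 h₂).2.1)
  rw [← Fin.card_Iic, delay, ← Finset.card_union_of_disjoint (by convert hdisj)]
  congr 1 with t
  simp only [Finset.mem_filter, Finset.mem_univ, true_and, Finset.mem_union, Finset.mem_Iic,
    interval, Set.mem_Ioo, ← τ.l_strictMono.le_iff_le]
  grind [τ.l_lt_r s]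

lemma lt_add_delay_iff (s t : Fin T) : (t : ℕ) < (s : ℕ) + 1 + τ.delay s ↔ τ.l t < τ.r s := by
  rw [← card_l_lt_r]
  exact lt_card_filter_iff (fun _ _ hij hj => (τ.l_strictMono.monotone hij).trans_lt hj) t

lemma add_delay_lt_iff (s t : Fin T) : (s : ℕ) + τ.delay s < t ↔ τ.r s < τ.l t := by
  rw [lt_iff_le_and_ne (a := τ.r s), and_iff_left (τ.l_ne_r t s).symm, ← not_lt,
    ← lt_add_delay_iff]
  lia

lemma add_delay_lt (s : Fin T) : (s : ℕ) + τ.delay s < T := by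
  have hcard := Finset.card_le_univ (Finset.univ.filter fun t => τ.l t < τ.r s)
  rw [card_l_lt_r, Fintype.card_fin] at hcard
  lia

lemma add_delay_obsOrder_lt_iff (m t : Fin T) :
    (τ.obsOrder m : ℕ) + τ.delay (τ.obsOrder m) < t ↔ (m : ℕ) < τ.seen t := by
  rw [add_delay_lt_iff, seen, lt_obsCount_iff]

lemma add_delay_mono {s t : Fin T} (h : τ.r s ≤ τ.r t) :
    (s : ℕ) + τ.delay s ≤ (t : ℕ) + τ.delay t := by
  have hcard := Finset.card_le_card <|
    Finset.monotone_filter_right Finset.univ fun i _ (hi : τ.l i < τ.r s) => hi.trans_le h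
  rw [card_l_lt_r, card_l_lt_r] at hcard
  lia

lemma dualBacklog_add_obsPos (t : Fin T) :
    τ.dualBacklog t + τ.obsPos t = (t : ℕ) + τ.delay t := by
  classical
  have hdisj : Disjoint (Finset.univ.filter fun s => τ.r s < τ.r t)
      (Finset.univ.filter fun s => τ.r t ∈ τ.interval s) :=
    Finset.disjoint_filter.2 fun s _ h₁ h₂ => h₁.not_gt h₂.2
  have hinsert : (Finset.univ.filter fun s => τ.l s < τ.r t)
      = insert t ((Finset.univ.filter fun s => τ.r s < τ.r t)
        ∪ Finset.univ.filter fun s => τ.r t ∈ τ.interval s) := by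
    ext s
    simp only [Finset.mem_filter, Finset.mem_univ, true_and, Finset.mem_union, Finset.mem_insert,
      interval, Set.mem_Ioo, ← τ.r_injective.eq_iff]
    grind [τ.l_lt_r s]
  have hcard := τ.card_l_lt_r t
  rw [hinsert, Finset.card_insert_of_notMem (by simp [interval]),
    Finset.card_union_of_disjoint hdisj] at hcard
  rw [add_right_comm (t : ℕ), Nat.add_right_cancel_iff, add_comm] at hcard
  rw [obsPos_eq_obsCount, obsCount, dualBacklog]
  convert hcard

lemma sum_dualBacklog : ∑ t, τ.dualBacklog t = τ.totalDelay := by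
  have hsum : ∑ t, τ.dualBacklog t + ∑ t : Fin T, (τ.obsPos t : ℕ)
      = ∑ t : Fin T, (t : ℕ) + ∑ t, τ.delay t := by
    simp only [← Finset.sum_add_distrib, dualBacklog_add_obsPos]
  have hperm : ∑ t : Fin T, (τ.obsPos t : ℕ) = ∑ t : Fin T, (t : ℕ) :=
    Equiv.sum_comp τ.obsOrder.symm fun t : Fin T => (t : ℕ)
  rw [totalDelay]
  lia

-- Every earlier round is either already observed at time `l_t`, or still has `l_t` in its interval.
lemma sum_seen_add_totalDelay : ∑ t, τ.seen t + τ.totalDelay = ∑ t : Fin T, (t : ℕ) := by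
  classical
  have hdelay : τ.totalDelay
      = ∑ t, (Finset.univ.filter fun s => τ.l t ∈ τ.interval s).card := by
    simp only [totalDelay, delay, Finset.card_filter]
    exact Finset.sum_comm
  rw [hdelay, ← Finset.sum_add_distrib]
  refine Finset.sum_congr rfl fun t _ => ?_
  have hdisj : Disjoint (Finset.univ.filter fun s => τ.r s < τ.l t)
      (Finset.univ.filter fun s => τ.l t ∈ τ.interval s) :=
    Finset.disjoint_filter.2 fun s _ h₁ h₂ => h₁.not_gt h₂.2
  rw [seen, obsCount, ← Finset.card_union_of_disjoint (by convert hdisj), ← Fin.card_Iio t]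
  congr 1 with s
  simp only [Finset.mem_filter, Finset.mem_univ, true_and, Finset.mem_union, Finset.mem_Iio,
    interval, Set.mem_Ioo, ← τ.l_strictMono.lt_iff_lt]
  grind [τ.l_lt_r s, τ.l_ne_r t s]

lemma sum_Ico_seen_obsPos (h : ℕ → ℝ) (t : Fin T) [DecidablePred (· ∈ τ.interval t)] :
    ∑ m ∈ Finset.Ico (τ.seen t) (τ.obsPos t), h m
      = ∑ m : Fin T, if τ.r (τ.obsOrder m) ∈ τ.interval t then h m else 0 := by
  have hIco : Finset.Ico (τ.seen t) (τ.obsPos t)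
      = (Finset.range T).filter fun m => τ.seen t ≤ m ∧ m < τ.obsPos t := by
    ext m
    have := (τ.obsPos t).2
    simp only [Finset.mem_Ico, Finset.mem_filter, Finset.mem_range]
    lia
  rw [hIco, Finset.sum_filter, ← Fin.sum_univ_eq_sum_range
    (fun m => if τ.seen t ≤ m ∧ m < τ.obsPos t then h m else 0) T]
  refine Finset.sum_congr rfl fun m _ => if_congr ?_ rfl rfl
  rw [interval, Set.mem_Ioo, ← τ.obsPos_lt_iff, obsPos_obsOrder, ← not_lt, seen,
    lt_obsCount_iff, not_lt, Fin.lt_def, (τ.l_ne_r _ _).le_iff_lt]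

-- Both sides sum `h m` over the pairs `(t, m)` such that the `m`-th observation falls in `I_t`.
lemma sum_sum_Ico_seen_obsPos (h : ℕ → ℝ) :
    ∑ t, ∑ m ∈ Finset.Ico (τ.seen t) (τ.obsPos t), h m
      = ∑ m : Fin T, τ.dualBacklog (τ.obsOrder m) * h m := by
  classical
  simp only [sum_Ico_seen_obsPos]
  rw [Finset.sum_comm]
  refine Finset.sum_congr rfl fun m _ => ?_
  rw [← Finset.sum_filter, Finset.sum_const, nsmul_eq_mul, dualBacklog]

end Timeline

/-! ### Loss vectors and iterates inside the wrapper -/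

section WrapperStructure

variable {k T : ℕ} (B : OLOAlgorithm k) (r : ℝ) (δ : ℕ → ℝ) (τ : Timeline T)
  (f : Fin T → Eucl k → ℝ) (u : Fin T → USphere k)

/-- The loss vector of round `s` that the wrapper sends to the base algorithm. -/
noncomputable def wrapperLoss (s : Fin T) : Eucl k :=
  ((k : ℝ) / δ ((s : ℕ) + 1) * f s (wrapperPred B r δ τ f u s)) • (u s : Eucl k)

/-- The loss vectors in the order of observation, indexed from `0` and continued by `0` after the
last observation. -/
noncomputable def observedLoss (m : ℕ) : Eucl k :=
  if h : m < T then wrapperLoss B r δ τ f u (τ.obsOrder ⟨m, h⟩) else 0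

variable {B r δ τ f u}

@[simp] lemma observedLoss_coe (m : Fin T) :
    observedLoss B r δ τ f u m = wrapperLoss B r δ τ f u (τ.obsOrder m) := dif_pos m.2

lemma wrapperState_succ {n : ℕ} (h : n < T) : wrapperState B r δ τ f u (n + 1)
    = wrapperRound B r δ τ f u ⟨n, h⟩ (wrapperState B r δ τ f u n) := by
  rw [wrapperState, dif_pos h]

lemma wrapperState_pred_eq {n : ℕ} (hn : n ≤ T) {t : Fin T} (ht : (t : ℕ) < n) :
    (wrapperState B r δ τ f u n).pred t = wrapperPred B r δ τ f u t := by
  induction hn using Nat.decreasingInduction with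
  | self => rfl
  | of_succ m hm ih =>
    have hne : t ≠ ⟨m, hm⟩ := fun h => ht.ne (congrArg Fin.val h)
    rw [← ih (ht.trans m.lt_succ_self), wrapperState_succ hm, wrapperRound]
    exact (Function.update_of_ne hne _ _).symm

lemma wrapperPred_eq (t : Fin T) : wrapperPred B r δ τ f u t
    = (1 - δ ((t : ℕ) + 1) / r) • B (wrapperState B r δ τ f u t).sent
      + δ ((t : ℕ) + 1) • (u t : Eucl k) := by
  rw [← wrapperState_pred_eq t.2 (Nat.lt_succ_self t), wrapperState_succ t.2, wrapperRound]
  exact Function.update_self ..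

lemma wrapperState_sent {n : ℕ} (hn : n ≤ T) : (wrapperState B r δ τ f u n).sent
    = (((List.finRange T).map τ.obsOrder).filter fun s : Fin T => (s : ℕ) + τ.delay s < n).map
        fun s => (wrapperLoss B r δ τ f u s, τ.dualDelay s, τ.dualBacklog s) := by
  induction n with
  | zero => simp [wrapperState]
  | succ n ih =>
    have hsort : ((List.finRange T).map τ.obsOrder).Pairwise
        fun a b : Fin T => (a : ℕ) + τ.delay a ≤ (b : ℕ) + τ.delay b :=
      List.pairwise_map.2 <| (List.pairwise_lt_finRange T).imp fun hab =>
        τ.add_delay_mono (τ.strictMono_r_obsOrder hab).le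
    rw [← filter_lt_append_filter_eq (fun s : Fin T => (s : ℕ) + τ.delay s) n hsort,
      List.map_append, ← ih (Nat.le_of_succ_le hn), wrapperState_succ hn, wrapperRound,
      Timeline.observedIn]
    refine congrArg _ (List.map_congr_left fun s hs => ?_)
    have hs' : (s : ℕ) + τ.delay s = n := by simpa using (List.mem_filter.1 hs).2
    have hpred := wrapperState_pred_eq (B := B) (r := r) (δ := δ) (τ := τ) (f := f) (u := u) hn
      (t := s) (by lia)
    rw [wrapperState_succ hn, wrapperRound] at hpred
    rw [wrapperLoss, ← hpred]

end WrapperStructure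

section WrapperFTRL

variable {k T : ℕ} (K : Set (Eucl k)) (z₁ : Eucl k) (η : ℕ → ℝ) (r : ℝ) (δ : ℕ → ℝ)
  (τ : Timeline T) (f : Fin T → Eucl k → ℝ) (u : Fin T → USphere k)

/-- The iterates of P-FTRL inside the wrapper: `wrapperIterate … n` is the output of the base
algorithm after `n` observations. -/
noncomputable def wrapperIterate (n : ℕ) : Eucl k :=
  pftrlIterate K z₁ η (observedLoss (pftrl K z₁ η) r δ τ f u) n

/-- The centre `(1 - δ_t/r) z̄` of the sphere from which the prediction of round `t` is drawn. -/
noncomputable def wrapperCenter (t : Fin T) : Eucl k :=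
  (1 - δ ((t : ℕ) + 1) / r) • wrapperIterate K z₁ η r δ τ f u (τ.seen t)

/-- The conditional mean of the loss vector of round `t`, given the directions of the rounds
observed before the prediction of round `t`. -/
noncomputable def wrapperMeanLoss (t : Fin T) : Eucl k :=
  meanGrad (f t) (δ ((t : ℕ) + 1)) (wrapperCenter K z₁ η r δ τ f u t)

variable {K z₁ η r δ τ f u}

lemma pftrl_wrapperState_sent (t : Fin T) :
    pftrl K z₁ η (wrapperState (pftrl K z₁ η) r δ τ f u t).sent
      = wrapperIterate K z₁ η r δ τ f u (τ.seen t) := by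
  have hlist : ((List.finRange T).map τ.obsOrder).filter
      (fun s : Fin T => (s : ℕ) + τ.delay s < t)
      = ((List.finRange T).take (τ.seen t)).map τ.obsOrder := by
    simp only [List.filter_map, ← filter_lt_finRange, Function.comp_def,
      τ.add_delay_obsOrder_lt_iff]
  have hle : τ.seen t ≤ T := τ.obsCount_le _
  rw [wrapperState_sent t.2.le, hlist, pftrl, wrapperIterate]
  simp only [List.length_map, List.length_take, List.length_finRange, min_eq_left hle]
  refine pftrlIterate_congr _ _ _ fun m hm => ?_
  have hmT : m < T := hm.trans_le hle
  rw [observedLoss, dif_pos hmT, List.getD_eq_getElem _ _ (by simp [hm, hmT])]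
  simp

lemma wrapperPred_pftrl (t : Fin T) : wrapperPred (pftrl K z₁ η) r δ τ f u t
    = wrapperCenter K z₁ η r δ τ f u t + δ ((t : ℕ) + 1) • (u t : Eucl k) := by
  rw [wrapperPred_eq, pftrl_wrapperState_sent, wrapperCenter]

lemma wrapperLoss_pftrl (t : Fin T) : wrapperLoss (pftrl K z₁ η) r δ τ f u t
    = gradEst (f t) (δ ((t : ℕ) + 1)) (wrapperCenter K z₁ η r δ τ f u t) (u t) := by
  rw [wrapperLoss, wrapperPred_pftrl, gradEst]

-- The feedback of round `t` is the only channel through which `u_t` reaches the base algorithm.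
lemma wrapperIterate_update {t : Fin T} {n : ℕ} (hn : n ≤ τ.obsPos t) (v : USphere k) :
    wrapperIterate K z₁ η r δ τ f (Function.update u t v) n
      = wrapperIterate K z₁ η r δ τ f u n := by
  induction n using Nat.strong_induction_on with
  | _ n ih =>
    refine pftrlIterate_congr _ _ _ fun m hm => ?_
    obtain ⟨s, hs⟩ : ∃ s, (τ.obsPos s : ℕ) = m :=
      ⟨τ.obsOrder ⟨m, hm.trans (hn.trans_lt (τ.obsPos t).2)⟩, by simp⟩
    have hst : s ≠ t := by
      rintro rfl
      lia
    have hseen := τ.seen_le_obsPos s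
    rw [← hs, observedLoss_coe, observedLoss_coe, τ.obsOrder_obsPos, wrapperLoss_pftrl,
      wrapperLoss_pftrl, wrapperCenter, wrapperCenter, ih (τ.seen s) (by lia) (by lia),
      Function.update_of_ne hst]

lemma wrapperCenter_update {s t : Fin T} (hst : τ.seen s ≤ τ.obsPos t) (v : USphere k) :
    wrapperCenter K z₁ η r δ τ f (Function.update u t v) s
      = wrapperCenter K z₁ η r δ τ f u s := by
  rw [wrapperCenter, wrapperIterate_update hst, wrapperCenter]

end WrapperFTRL

/-! ### Resampling one coordinate of a product measure -/

section Resample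

variable {ι : Type*} [Fintype ι] [DecidableEq ι] {X : ι → Type*} [∀ i, MeasurableSpace (X i)]
  (ν : ∀ i, Measure (X i)) [∀ i, IsProbabilityMeasure (ν i)]

lemma measurePreserving_update (i : ι) :
    MeasurePreserving (fun p : (∀ i, X i) × X i => Function.update p.1 i p.2)
      ((Measure.pi ν).prod (ν i)) (Measure.pi ν) := by
  have hmeas : Measurable fun p : (∀ i, X i) × X i => Function.update p.1 i p.2 :=
    measurable_update'
  refine ⟨hmeas, (Measure.pi_eq fun s hs => ?_).symm⟩
  have hpre : (fun p : (∀ i, X i) × X i => Function.update p.1 i p.2) ⁻¹' Set.univ.pi s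
      = (Set.univ.pi (Function.update s i Set.univ)) ×ˢ s i := by
    ext p
    simp only [Set.mem_preimage, Set.mem_prod, Set.mem_univ_pi,
      Function.forall_update_iff _ fun j x => x ∈ s j,
      Function.forall_update_iff _ fun j t => p.1 j ∈ t, Set.mem_univ, true_and, and_comm]
  have hν : ∀ j, ν j (Function.update s i Set.univ j)
      = Function.update (fun j => ν j (s j)) i 1 j := fun j => by
    rw [Function.apply_update fun j => ν j, measure_univ]
  rw [Measure.map_apply hmeas (MeasurableSet.univ_pi hs), hpre, Measure.prod_prod, Measure.pi_pi]
  simp only [hν]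
  rw [Finset.prod_update_of_mem (Finset.mem_univ i), one_mul,
    ← Finset.prod_sdiff (Finset.subset_univ {i}), Finset.prod_singleton]

lemma integral_pi_eq_integral_update {E : Type*} [NormedAddCommGroup E] [NormedSpace ℝ E] (i : ι)
    {F : (∀ i, X i) → E} (hF : Integrable F (Measure.pi ν)) :
    ∫ x, F x ∂(Measure.pi ν) = ∫ x, ∫ v, F (Function.update x i v) ∂(ν i) ∂(Measure.pi ν) := by
  have hmp := measurePreserving_update ν i
  conv_lhs => rw [← hmp.map_eq]
  rw [integral_map hmp.measurable.aemeasurable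
    (by rw [hmp.map_eq]; exact hF.aestronglyMeasurable)]
  exact integral_prod _ (hmp.integrable_comp_of_integrable hF)

end Resample

section GradientEstimateContinuity

variable {X : Type*} [TopologicalSpace X] {k : ℕ} {K : Set (Eucl k)} {f : Eucl k → ℝ} {δ : ℝ}
  {y : X → Eucl k}

lemma continuous_gradEst_comp {v : X → USphere k} (hf : ContinuousOn f K) (hy : Continuous y)
    (hv : Continuous v) (hmem : ∀ x, y x + δ • (v x : Eucl k) ∈ K) :
    Continuous fun x => gradEst f δ (y x) (v x) := by
  have hcoe : Continuous fun x => (v x : Eucl k) := continuous_subtype_val.comp hv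
  have hval : Continuous fun x => f (y x + δ • (v x : Eucl k)) :=
    hf.comp_continuous (by fun_prop) hmem
  exact (continuous_const.mul hval).smul hcoe

lemma continuous_meanGrad_comp [NeZero k] [FirstCountableTopology X] [LocallyCompactSpace X]
    (hf : ContinuousOn f K) (hy : Continuous y)
    (hmem : ∀ x, ∀ v : USphere k, y x + δ • (v : Eucl k) ∈ K) :
    Continuous fun x => meanGrad f δ (y x) := by
  have hjoint : Continuous (Function.uncurry fun (x : X) (v : USphere k) =>
      gradEst f δ (y x) v) :=
    continuous_gradEst_comp hf (hy.comp continuous_fst) continuous_snd fun p => hmem p.1 p.2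
  simpa only [meanGrad, Measure.restrict_univ] using
    continuous_parametric_integral_of_continuous (μ := unifSphere k) hjoint isCompact_univ

end GradientEstimateContinuity

/-! ### Regret of the wrapper -/

instance isProbabilityMeasure_directionLaw (k T : ℕ) [NeZero k] :
    IsProbabilityMeasure (directionLaw k T) := by
  unfold directionLaw
  infer_instance

/-- The standing assumptions of the regret analysis: a compact convex domain `K` of diameter at
most `D` that contains `z₁` and the ball of radius `r` about `0`, positive nonincreasing learning
rates, smoothing parameters in `(0, r]`, and convex `G`-Lipschitz losses bounded by `M`. -/
structure WrapperAssumptions {k T : ℕ} (K : Set (Eucl k)) (z₁ : Eucl k) (η : ℕ → ℝ) (r : ℝ)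
    (δ : ℕ → ℝ) (f : Fin T → Eucl k → ℝ) (D : ℝ) (G : ℝ≥0) (M : ℝ) : Prop where
  compact : IsCompact K
  convex : Convex ℝ K
  start_mem : z₁ ∈ K
  r_pos : 0 < r
  ball_subset : closedBall 0 r ⊆ K
  diam_le : ∀ x ∈ K, ∀ y ∈ K, ‖x - y‖ ≤ D
  rate_pos : ∀ n, 0 < η (n + 1)
  weight_nonneg : ∀ n, 0 ≤ stepWeight η n
  delta_pos : ∀ t : Fin T, 0 < δ ((t : ℕ) + 1)
  delta_le : ∀ t : Fin T, δ ((t : ℕ) + 1) ≤ r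
  G_pos : 0 < G
  loss_convex : ∀ t, ConvexOn ℝ K (f t)
  loss_lipschitz : ∀ t, LipschitzOnWith G (f t) K
  loss_bounded : ∀ t, ∀ x ∈ K, |f t x| ≤ M

lemma le_diam_of_closedBall_subset {k : ℕ} [NeZero k] {K : Set (Eucl k)} {r D : ℝ} (hr : 0 ≤ r)
    (hball : closedBall 0 r ⊆ K) (hdiam : ∀ x ∈ K, ∀ y ∈ K, ‖x - y‖ ≤ D) : r ≤ D := by
  have he : ‖(EuclideanSpace.single 0 r : Eucl k)‖ = r := by
    simp [abs_of_nonneg hr]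
  calc r = ‖(EuclideanSpace.single 0 r : Eucl k) - 0‖ := by rw [sub_zero, he]
    _ ≤ D := hdiam _ (hball (mem_closedBall_zero_iff.2 he.le)) _ (hball (mem_closedBall_self hr))

namespace WrapperAssumptions

variable {k T : ℕ} {K : Set (Eucl k)} {z₁ : Eucl k} {η : ℕ → ℝ} {r : ℝ} {δ : ℕ → ℝ}
  {f : Fin T → Eucl k → ℝ} {D : ℝ} {G : ℝ≥0} {M : ℝ}

section Domain

variable (H : WrapperAssumptions K z₁ η r δ f D G M)

include H

lemma zero_mem : (0 : Eucl k) ∈ K :=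
  H.ball_subset (mem_closedBall_self H.r_pos.le)

lemma r_le_diam [NeZero k] : r ≤ D :=
  le_diam_of_closedBall_subset H.r_pos.le H.ball_subset H.diam_le

lemma diam_pos [NeZero k] : 0 < D := H.r_pos.trans_le H.r_le_diam

lemma delta_div_le_one (t : Fin T) : δ ((t : ℕ) + 1) / r ≤ 1 :=
  (div_le_one H.r_pos).2 (H.delta_le t)

lemma delta_div_nonneg (t : Fin T) : 0 ≤ δ ((t : ℕ) + 1) / r :=
  div_nonneg (H.delta_pos t).le H.r_pos.le

lemma closedBall_shrink_subset (t : Fin T) {z : Eucl k} (hz : z ∈ K) :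
    closedBall ((1 - δ ((t : ℕ) + 1) / r) • z) (δ ((t : ℕ) + 1)) ⊆ K := by
  have hr := H.r_pos
  have hδ := H.delta_pos t
  intro y hy
  set a := δ ((t : ℕ) + 1) / r with ha
  set w := a⁻¹ • (y - (1 - a) • z) with hw
  have ha0 : 0 < a := div_pos hδ hr
  have hwK : w ∈ K := by
    refine H.ball_subset (mem_closedBall_zero_iff.2 ?_)
    rw [mem_closedBall, dist_eq_norm] at hy
    rw [hw, norm_smul, norm_inv, Real.norm_eq_abs, abs_of_pos ha0, inv_mul_le_iff₀ ha0, ha,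
      div_mul_cancel₀ _ hr.ne']
    exact hy
  have hcomb := H.convex hz hwK (sub_nonneg.2 (H.delta_div_le_one t)) ha0.le (by ring)
  rwa [hw, smul_inv_smul₀ ha0.ne', add_sub_cancel] at hcomb

lemma shrink_mem (t : Fin T) {z : Eucl k} (hz : z ∈ K) :
    (1 - δ ((t : ℕ) + 1) / r) • z ∈ K :=
  H.closedBall_shrink_subset t hz (mem_closedBall_self (H.delta_pos t).le)

lemma loss_sub_le (t : Fin T) {x y : Eucl k} (hx : x ∈ K) (hy : y ∈ K) :
    f t x - f t y ≤ G * ‖x - y‖ := by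
  rw [sub_le_iff_le_add', ← dist_eq_norm]
  exact (H.loss_lipschitz t).le_add_mul hx hy

lemma sum_range_stepWeight_pos (n : ℕ) : 0 < ∑ m ∈ Finset.range (n + 1), stepWeight η m := by
  rw [sum_stepWeight]
  exact one_div_pos.2 (H.rate_pos n)

end Domain

section Membership

variable (H : WrapperAssumptions K z₁ η r δ f D G M) (τ : Timeline T) (u : Fin T → USphere k)

include H

lemma isProximalFTRL : IsProximalFTRL K (observedLoss (pftrl K z₁ η) r δ τ f u) (stepWeight η)
    (wrapperIterate K z₁ η r δ τ f u) :=
  isProximalFTRL_pftrlIterate H.compact H.convex H.start_mem _ _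

lemma iterate_mem (n : ℕ) : wrapperIterate K z₁ η r δ τ f u n ∈ K :=
  (H.isProximalFTRL τ u).mem n

lemma closedBall_center_subset (t : Fin T) :
    closedBall (wrapperCenter K z₁ η r δ τ f u t) (δ ((t : ℕ) + 1)) ⊆ K :=
  H.closedBall_shrink_subset t (H.iterate_mem τ u _)

lemma center_mem (t : Fin T) : wrapperCenter K z₁ η r δ τ f u t ∈ K :=
  H.shrink_mem t (H.iterate_mem τ u _)

lemma center_add_mem (t : Fin T) (v : USphere k) :
    wrapperCenter K z₁ η r δ τ f u t + δ ((t : ℕ) + 1) • (v : Eucl k) ∈ K :=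
  H.closedBall_center_subset τ u t (add_smul_sphere_mem_closedBall (H.delta_pos t).le _ v)

lemma pred_mem (t : Fin T) : wrapperPred (pftrl K z₁ η) r δ τ f u t ∈ K := by
  rw [wrapperPred_pftrl]
  exact H.center_add_mem τ u t (u t)

lemma norm_meanLoss_le [NeZero k] (t : Fin T) : ‖wrapperMeanLoss K z₁ η r δ τ f u t‖ ≤ G :=
  norm_meanGrad_le (H.delta_pos t)
    ((H.loss_lipschitz t).mono (H.closedBall_center_subset τ u t))

lemma norm_loss_le (t : Fin T) :
    ‖wrapperLoss (pftrl K z₁ η) r δ τ f u t‖ ≤ k * M / δ ((t : ℕ) + 1) := by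
  rw [wrapperLoss_pftrl]
  exact norm_gradEst_le (H.delta_pos t)
    (fun x hx => H.loss_bounded t x (H.closedBall_center_subset τ u t hx)) _

end Membership

section Continuity

variable (H : WrapperAssumptions K z₁ η r δ f D G M) (τ : Timeline T)

include H

lemma continuous_iterate (n : ℕ) : Continuous fun u => wrapperIterate K z₁ η r δ τ f u n := by
  induction n using Nat.strong_induction_on with
  | _ n ih =>
    refine continuous_pftrlIterate H.compact H.convex H.start_mem H.rate_pos fun m hm => ?_
    by_cases hmT : m < T
    · set s := τ.obsOrder ⟨m, hmT⟩ with hs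
      have hseen : τ.seen s < n := by
        have := τ.seen_le_obsPos s
        rw [hs, τ.obsPos_obsOrder] at this
        exact this.trans_lt hm
      have hcenter : Continuous fun u => wrapperCenter K z₁ η r δ τ f u s :=
        (ih _ hseen).const_smul (1 - δ ((s : ℕ) + 1) / r)
      simp only [observedLoss, dif_pos hmT, wrapperLoss_pftrl, ← hs]
      exact continuous_gradEst_comp (H.loss_lipschitz s).continuousOn hcenter
        (continuous_apply s) fun u => H.center_add_mem τ u s (u s)
    · simp only [observedLoss, dif_neg hmT]
      exact continuous_const

lemma continuous_center (t : Fin T) : Continuous fun u => wrapperCenter K z₁ η r δ τ f u t :=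
  (H.continuous_iterate τ (τ.seen t)).const_smul (1 - δ ((t : ℕ) + 1) / r)

lemma continuous_pred (t : Fin T) :
    Continuous fun u => wrapperPred (pftrl K z₁ η) r δ τ f u t := by
  have hdir : Continuous fun u : Fin T → USphere k => δ ((t : ℕ) + 1) • (u t : Eucl k) := by
    fun_prop
  simp only [wrapperPred_pftrl]
  exact (H.continuous_center τ t).add hdir

lemma continuous_regret (x : Eucl k) :
    Continuous fun u => wrapperRegret (pftrl K z₁ η) r δ τ f u x :=
  continuous_finsetSum _ fun t _ =>
    ((H.loss_lipschitz t).continuousOn.comp_continuous (H.continuous_pred τ t)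
      fun u => H.pred_mem τ u t).sub continuous_const

lemma continuous_loss (t : Fin T) :
    Continuous fun u => wrapperLoss (pftrl K z₁ η) r δ τ f u t := by
  simp only [wrapperLoss_pftrl]
  exact continuous_gradEst_comp (H.loss_lipschitz t).continuousOn (H.continuous_center τ t)
    (continuous_apply t) fun u => H.center_add_mem τ u t (u t)

lemma continuous_meanLoss [NeZero k] (t : Fin T) :
    Continuous fun u => wrapperMeanLoss K z₁ η r δ τ f u t :=
  continuous_meanGrad_comp (H.loss_lipschitz t).continuousOn (H.continuous_center τ t)
    fun u v => H.center_add_mem τ u t v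

end Continuity

section Regret

variable [NeZero k] (H : WrapperAssumptions K z₁ η r δ f D G M) (τ : Timeline T)

include H

lemma integrable_regret (x : Eucl k) :
    Integrable (fun u => wrapperRegret (pftrl K z₁ η) r δ τ f u x) (directionLaw k T) :=
  integrable_of_continuous_of_compactSpace (H.continuous_regret τ x)

lemma integral_regret_le_of_forall {x : Eucl k} {c : ℝ}
    (h : ∀ u, wrapperRegret (pftrl K z₁ η) r δ τ f u x ≤ c) :
    ∫ u, wrapperRegret (pftrl K z₁ η) r δ τ f u x ∂(directionLaw k T) ≤ c := by
  simpa using integral_mono (H.integrable_regret τ x) (integrable_const c) h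

lemma integral_regret_le_of_lipschitz {x : Eucl k} (hx : x ∈ K) :
    ∫ u, wrapperRegret (pftrl K z₁ η) r δ τ f u x ∂(directionLaw k T) ≤ T * (G * D) := by
  refine H.integral_regret_le_of_forall τ fun u => ?_
  calc _ ≤ ∑ _t : Fin T, G * D := Finset.sum_le_sum fun t _ =>
        (H.loss_sub_le t (H.pred_mem τ u t) hx).trans <|
          mul_le_mul_of_nonneg_left (H.diam_le _ (H.pred_mem τ u t) _ hx) G.2
    _ = T * (G * D) := by simp

lemma integral_regret_le_of_bounded {x : Eucl k} (hx : x ∈ K) :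
    ∫ u, wrapperRegret (pftrl K z₁ η) r δ τ f u x ∂(directionLaw k T) ≤ T * (2 * M) := by
  refine H.integral_regret_le_of_forall τ fun u => ?_
  calc _ ≤ ∑ _t : Fin T, 2 * M := Finset.sum_le_sum fun t _ => by
        have hpred := (abs_le.1 (H.loss_bounded t _ (H.pred_mem τ u t))).2
        have hcomp := (abs_le.1 (H.loss_bounded t _ hx)).1
        linarith
    _ = T * (2 * M) := by simp

-- The constant is `1 + 4 + 1 + 1`: exploration, smoothing bias, and shrinking the comparator and
-- the iterate.
lemma round_regret_le (u : Fin T → USphere k) (t : Fin T) {x : Eucl k} (hx : x ∈ K) :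
    f t (wrapperPred (pftrl K z₁ η) r δ τ f u t) - f t x
      ≤ ⟪wrapperMeanLoss K z₁ η r δ τ f u t, wrapperIterate K z₁ η r δ τ f u (τ.seen t) - x⟫
        + 7 * (G * D) * (δ ((t : ℕ) + 1) / r) := by
  set z := wrapperIterate K z₁ η r δ τ f u (τ.seen t)
  set y := wrapperCenter K z₁ η r δ τ f u t with hy
  set g := wrapperMeanLoss K z₁ η r δ τ f u t
  set a := δ ((t : ℕ) + 1) / r with ha
  have ha0 : 0 ≤ a := H.delta_div_nonneg t
  have hδ : δ ((t : ℕ) + 1) = a * r := (div_mul_cancel₀ _ H.r_pos.ne').symm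
  have hrD := H.r_le_diam
  have hpred : f t (wrapperPred (pftrl K z₁ η) r δ τ f u t) - f t y ≤ G * (a * r) := by
    refine (H.loss_sub_le t (H.pred_mem τ u t) (H.center_mem τ u t)).trans_eq ?_
    rw [wrapperPred_pftrl, add_sub_cancel_left, norm_smul, norm_eq_of_mem_sphere, mul_one, hδ,
      Real.norm_of_nonneg (mul_nonneg ha0 H.r_pos.le)]
  have hlin : ⟪g, (1 - a) • x - y⟫ ≤ f t ((1 - a) • x) - f t y + 4 * G * (a * r) := by
    rw [← hδ]
    exact inner_meanGrad_sub_le (H.delta_pos t) (H.loss_convex t) (H.loss_lipschitz t)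
      (H.closedBall_center_subset τ u t) (H.closedBall_shrink_subset t hx)
  have hcomp : f t ((1 - a) • x) - f t x ≤ G * (a * D) := by
    refine (H.loss_sub_le t (H.shrink_mem t hx) hx).trans ?_
    rw [show (1 - a) • x - x = a • (0 - x) by module, norm_smul, Real.norm_of_nonneg ha0]
    gcongr
    exact H.diam_le _ H.zero_mem _ hx
  have hscale : ⟪g, (1 - a) • x - y⟫ = -((1 - a) * ⟪g, z - x⟫) := by
    rw [hy, wrapperCenter, ← ha, ← smul_sub, real_inner_smul_right, ← neg_sub z x,
      inner_neg_right, mul_neg]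
  have hinner : -(G * D) ≤ ⟪g, z - x⟫ := neg_le_of_abs_le <|
    (abs_real_inner_le_norm _ _).trans <| mul_le_mul (H.norm_meanLoss_le τ u t)
      (H.diam_le _ (H.iterate_mem τ u _) _ hx) (norm_nonneg _) G.2
  have hGr : G * (a * r) ≤ G * (a * D) := by gcongr
  have hainner := mul_le_mul_of_nonneg_left hinner ha0
  linarith

-- Conditionally on the other directions `h u` is a constant, so only the mean of the loss counts.
lemma integral_inner_loss (t : Fin T) {h : (Fin T → USphere k) → Eucl k} (hh : Continuous h)
    (hu : ∀ u v, h (Function.update u t v) = h u) :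
    ∫ u, ⟪wrapperLoss (pftrl K z₁ η) r δ τ f u t, h u⟫ ∂(directionLaw k T)
      = ∫ u, ⟪wrapperMeanLoss K z₁ η r δ τ f u t, h u⟫ ∂(directionLaw k T) := by
  have hint : Integrable (fun u => ⟪wrapperLoss (pftrl K z₁ η) r δ τ f u t, h u⟫)
      (directionLaw k T) :=
    integrable_of_continuous_of_compactSpace ((H.continuous_loss τ t).inner hh)
  rw [directionLaw] at hint ⊢
  rw [integral_pi_eq_integral_update (fun _ => unifSphere k) t hint]
  congr 1 with u
  have hgrad : Integrable (gradEst (f t) (δ ((t : ℕ) + 1)) (wrapperCenter K z₁ η r δ τ f u t))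
      (unifSphere k) :=
    integrable_of_continuous_of_compactSpace <| continuous_gradEst_comp
      (H.loss_lipschitz t).continuousOn continuous_const continuous_id (H.center_add_mem τ u t)
  simp only [hu, wrapperLoss_pftrl, wrapperCenter_update (τ.seen_le_obsPos t),
    Function.update_self, wrapperMeanLoss, meanGrad, real_inner_comm (h u)]
  exact integral_inner hgrad (h u)

end Regret

end WrapperAssumptions

lemma Timeline.sum_Ico_eq_sum_obsPos {T : ℕ} (τ : Timeline T) {E : Type*} [AddCommMonoid E]
    {n m : ℕ} (hm : m ≤ T) (F : ℕ → E) :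
    ∑ j ∈ Finset.Ico n m, F j
      = ∑ t with n ≤ (τ.obsPos t : ℕ) ∧ (τ.obsPos t : ℕ) < m, F (τ.obsPos t) := by
  refine (Finset.sum_nbij (fun t => (τ.obsPos t : ℕ)) (fun t ht => ?_) (fun s _ t _ hst => ?_)
    (fun j hj => ?_) fun _ _ => rfl).symm
  · simpa using ht
  · exact τ.obsPos_injective (Fin.ext hst)
  · obtain ⟨hn, hjm⟩ := Finset.mem_Ico.1 hj
    exact ⟨τ.obsOrder ⟨j, hjm.trans_le hm⟩, by simp [hn, hjm], by simp⟩

lemma integral_norm_sq_sum_of_orthogonal {Ω E ι : Type*} [MeasurableSpace Ω] {μ : Measure Ω}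
    [NormedAddCommGroup E] [InnerProductSpace ℝ E] {s : Finset ι} {X : ι → Ω → E}
    (hint : ∀ i ∈ s, ∀ j ∈ s, Integrable (fun ω => ⟪X i ω, X j ω⟫) μ)
    (horth : ∀ i ∈ s, ∀ j ∈ s, i ≠ j → ∫ ω, ⟪X i ω, X j ω⟫ ∂μ = 0) :
    ∫ ω, ‖∑ i ∈ s, X i ω‖ ^ 2 ∂μ = ∑ i ∈ s, ∫ ω, ‖X i ω‖ ^ 2 ∂μ := by
  simp only [← real_inner_self_eq_norm_sq, sum_inner, inner_sum]
  rw [integral_finsetSum _ fun i hi => integrable_finsetSum _ fun j hj => hint j hj i hi]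
  refine Finset.sum_congr rfl fun i hi => ?_
  rw [integral_finsetSum _ fun j hj => hint j hj i hi]
  exact Finset.sum_eq_single_of_mem i hi fun j hj hji => horth j hj i hi hji

lemma le_sq_div_add_mul_sq {L G : ℝ} (hL : 0 < L) (hG : 0 < G) (X : ℝ) :
    X ≤ L ^ 2 / G + G / (4 * L ^ 2) * X ^ 2 := by
  have hsq : L ^ 2 / G + G / (4 * L ^ 2) * X ^ 2 - X
      = (2 * L ^ 2 - G * X) ^ 2 / (4 * L ^ 2 * G) := by
    field_simp
    ring
  exact sub_nonneg.1 (hsq ▸ by positivity)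

/-- The noise of the gradient estimate of round `t`: its deviation from its conditional mean. -/
noncomputable def lossNoise {k T : ℕ} (K : Set (Eucl k)) (z₁ : Eucl k) (η : ℕ → ℝ) (r : ℝ)
    (δ : ℕ → ℝ) (τ : Timeline T) (f : Fin T → Eucl k → ℝ) (u : Fin T → USphere k)
    (t : Fin T) : Eucl k :=
  wrapperLoss (pftrl K z₁ η) r δ τ f u t - wrapperMeanLoss K z₁ η r δ τ f u t

/-- The regret bound of P-FTRL on the loss vectors of the wrapper, in the order of observation. -/
noncomputable def linearRegretBound {T : ℕ} (k : ℕ) (η δ : ℕ → ℝ) (τ : Timeline T) (D M : ℝ) : ℝ :=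
  D ^ 2 / (2 * η T)
    + ∑ m : Fin T, η ((m : ℕ) + 1) * (k * M / δ ((τ.obsOrder m : ℕ) + 1)) ^ 2 / 2

namespace WrapperAssumptions

variable {k T : ℕ} {K : Set (Eucl k)} {z₁ : Eucl k} {η : ℕ → ℝ} {r : ℝ} {δ : ℕ → ℝ}
  {f : Fin T → Eucl k → ℝ} {D : ℝ} {G : ℝ≥0} {M : ℝ}

variable [NeZero k] (H : WrapperAssumptions K z₁ η r δ f D G M) (τ : Timeline T)

include H

section Noise

lemma continuous_noise (t : Fin T) : Continuous fun u => lossNoise K z₁ η r δ τ f u t :=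
  (H.continuous_loss τ t).sub (H.continuous_meanLoss τ t)

lemma norm_noise_le (u : Fin T → USphere k) (t : Fin T) :
    ‖lossNoise K z₁ η r δ τ f u t‖ ≤ 2 * (k * M / δ ((t : ℕ) + 1)) := by
  have hmean : ‖wrapperMeanLoss K z₁ η r δ τ f u t‖ ≤ k * M / δ ((t : ℕ) + 1) := by
    simpa only [wrapperMeanLoss, meanGrad, probReal_univ, mul_one] using
      norm_integral_le_of_norm_le_const (μ := unifSphere k) <| .of_forall <|
        norm_gradEst_le (H.delta_pos t)
          (fun x hx => H.loss_bounded t x (H.closedBall_center_subset τ u t hx))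
  exact (norm_sub_le _ _).trans (by linarith [H.norm_loss_le τ u t])

lemma integral_inner_noise (t : Fin T) {h : (Fin T → USphere k) → Eucl k} (hh : Continuous h)
    (hu : ∀ u v, h (Function.update u t v) = h u) :
    ∫ u, ⟪lossNoise K z₁ η r δ τ f u t, h u⟫ ∂(directionLaw k T) = 0 := by
  simp only [lossNoise, inner_sub_left]
  rw [integral_sub
    (integrable_of_continuous_of_compactSpace ((H.continuous_loss τ t).inner hh))
    (integrable_of_continuous_of_compactSpace ((H.continuous_meanLoss τ t).inner hh)),
    H.integral_inner_loss τ t hh hu, sub_self]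

lemma integral_inner_noise_noise {s t : Fin T} (hst : s ≠ t) :
    ∫ u, ⟪lossNoise K z₁ η r δ τ f u s, lossNoise K z₁ η r δ τ f u t⟫ ∂(directionLaw k T) = 0 := by
  wlog hlt : τ.obsPos t < τ.obsPos s generalizing s t
  · have hlt' := lt_of_le_of_ne (not_lt.1 hlt) fun h => hst (τ.obsPos_injective h)
    simpa only [real_inner_comm] using this hst.symm hlt'
  refine H.integral_inner_noise τ s (H.continuous_noise τ t) fun u v => ?_
  have hseen : τ.seen t ≤ τ.obsPos s := (τ.seen_le_obsPos t).trans (Fin.lt_def.1 hlt).le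
  rw [lossNoise, lossNoise, wrapperLoss_pftrl, wrapperLoss_pftrl, wrapperMeanLoss,
    wrapperMeanLoss, wrapperCenter_update hseen, Function.update_of_ne hst.symm]

variable {L : ℝ} (hL : ∀ t : Fin T, k * M / δ ((t : ℕ) + 1) ≤ L)

include hL

lemma integral_norm_sq_sum_noise_le (J : Finset (Fin T)) :
    ∫ u, ‖∑ t ∈ J, lossNoise K z₁ η r δ τ f u t‖ ^ 2 ∂(directionLaw k T)
      ≤ J.card * (4 * L ^ 2) := by
  have hcont := H.continuous_noise τ
  rw [integral_norm_sq_sum_of_orthogonal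
    (fun s _ t _ => integrable_of_continuous_of_compactSpace ((hcont s).inner (hcont t)))
    fun s _ t _ hst => H.integral_inner_noise_noise τ hst, ← nsmul_eq_mul]
  refine Finset.sum_le_card_nsmul _ _ _ fun t _ => ?_
  have hbound : ∀ u, ‖lossNoise K z₁ η r δ τ f u t‖ ^ 2 ≤ 4 * L ^ 2 := fun u => by
    have hnoise := (H.norm_noise_le τ u t).trans (mul_le_mul_of_nonneg_left (hL t) zero_le_two)
    nlinarith [norm_nonneg (lossNoise K z₁ η r δ τ f u t)]
  simpa using integral_mono
    (integrable_of_continuous_of_compactSpace ((hcont t).norm.pow 2))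
    (integrable_const (μ := directionLaw k T) (4 * L ^ 2)) hbound

-- By orthogonality the noise is of order `2 * L * √|J|`, which Young's inequality splits into
-- `L ^ 2 / G + G * |J|`.
lemma integral_norm_sum_loss_le (hL0 : 0 < L) (J : Finset (Fin T)) :
    ∫ u, ‖∑ t ∈ J, wrapperLoss (pftrl K z₁ η) r δ τ f u t‖ ∂(directionLaw k T)
      ≤ L ^ 2 / G + 2 * G * J.card := by
  have hG : (0 : ℝ) < G := H.G_pos
  have hnoise : Continuous fun u => ∑ t ∈ J, lossNoise K z₁ η r δ τ f u t :=
    continuous_finsetSum _ fun t _ => H.continuous_noise τ t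
  have hnoise_int : Integrable (fun u => G / (4 * L ^ 2)
      * ‖∑ t ∈ J, lossNoise K z₁ η r δ τ f u t‖ ^ 2) (directionLaw k T) :=
    (integrable_of_continuous_of_compactSpace (hnoise.norm.pow 2)).const_mul _
  have hloss_int : Integrable (fun u => ‖∑ t ∈ J, wrapperLoss (pftrl K z₁ η) r δ τ f u t‖)
      (directionLaw k T) := integrable_of_continuous_of_compactSpace
    (continuous_finsetSum _ fun t _ => H.continuous_loss τ t).norm
  have hpointwise : ∀ u, ‖∑ t ∈ J, wrapperLoss (pftrl K z₁ η) r δ τ f u t‖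
      ≤ (J.card * G + L ^ 2 / G)
        + G / (4 * L ^ 2) * ‖∑ t ∈ J, lossNoise K z₁ η r δ τ f u t‖ ^ 2 := fun u => by
    have hsplit : ∑ t ∈ J, wrapperLoss (pftrl K z₁ η) r δ τ f u t
        = ∑ t ∈ J, wrapperMeanLoss K z₁ η r δ τ f u t
          + ∑ t ∈ J, lossNoise K z₁ η r δ τ f u t := by
      simp only [lossNoise, ← Finset.sum_add_distrib, add_sub_cancel]
    have hmean : ‖∑ t ∈ J, wrapperMeanLoss K z₁ η r δ τ f u t‖ ≤ J.card * G := by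
      rw [← nsmul_eq_mul]
      exact (norm_sum_le _ _).trans <|
        Finset.sum_le_card_nsmul _ _ _ fun t _ => H.norm_meanLoss_le τ u t
    rw [hsplit]
    linarith [norm_add_le (∑ t ∈ J, wrapperMeanLoss K z₁ η r δ τ f u t)
        (∑ t ∈ J, lossNoise K z₁ η r δ τ f u t),
      le_sq_div_add_mul_sq hL0 hG ‖∑ t ∈ J, lossNoise K z₁ η r δ τ f u t‖]
  calc _ ≤ ∫ u, ((J.card * G + L ^ 2 / G) + G / (4 * L ^ 2)
          * ‖∑ t ∈ J, lossNoise K z₁ η r δ τ f u t‖ ^ 2) ∂(directionLaw k T) :=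
        integral_mono hloss_int ((integrable_const _).add hnoise_int) hpointwise
    _ = (J.card * G + L ^ 2 / G) + G / (4 * L ^ 2)
          * ∫ u, ‖∑ t ∈ J, lossNoise K z₁ η r δ τ f u t‖ ^ 2 ∂(directionLaw k T) := by
        rw [integral_add (integrable_const _) hnoise_int, integral_const_mul]
        simp
    _ ≤ (J.card * G + L ^ 2 / G) + G / (4 * L ^ 2) * (J.card * (4 * L ^ 2)) := by
        gcongr
        exact H.integral_norm_sq_sum_noise_le τ hL J
    _ = L ^ 2 / G + 2 * G * J.card := by
        field_simp
        ring

lemma integral_norm_sum_observedLoss_le (hL0 : 0 < L) {n m : ℕ} (hnm : n ≤ m) (hm : m ≤ T) :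
    ∫ u, ‖∑ j ∈ Finset.Ico n m, observedLoss (pftrl K z₁ η) r δ τ f u j‖ ∂(directionLaw k T)
      ≤ L ^ 2 / G + 2 * G * (m - n : ℝ) := by
  have hcard := τ.sum_Ico_eq_sum_obsPos (n := n) hm fun _ => (1 : ℝ)
  simp only [Finset.sum_const, Nat.card_Ico, nsmul_eq_mul, mul_one, Nat.cast_sub hnm] at hcard
  simp only [τ.sum_Ico_eq_sum_obsPos hm, observedLoss_coe, τ.obsOrder_obsPos, hcard]
  exact H.integral_norm_sum_loss_le τ hL hL0 _

end Noise

section Drift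

omit [NeZero k] in
lemma continuous_observedLoss (j : ℕ) :
    Continuous fun u => observedLoss (pftrl K z₁ η) r δ τ f u j := by
  simp only [observedLoss]
  split_ifs
  · exact H.continuous_loss τ _
  · exact continuous_const

lemma integrable_drift (n m : ℕ) :
    Integrable (fun u => ‖wrapperIterate K z₁ η r δ τ f u m - wrapperIterate K z₁ η r δ τ f u n‖)
      (directionLaw k T) :=
  integrable_of_continuous_of_compactSpace
    ((H.continuous_iterate τ m).sub (H.continuous_iterate τ n)).norm

lemma integral_drift_le_diam (n m : ℕ) :
    ∫ u, ‖wrapperIterate K z₁ η r δ τ f u m - wrapperIterate K z₁ η r δ τ f u n‖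
      ∂(directionLaw k T) ≤ D := by
  simpa using integral_mono (H.integrable_drift τ n m) (integrable_const D)
    fun u => H.diam_le _ (H.iterate_mem τ u m) _ (H.iterate_mem τ u n)

variable {L : ℝ} (hL : ∀ t : Fin T, k * M / δ ((t : ℕ) + 1) ≤ L)

include hL

lemma mul_integral_drift_le (hL0 : 0 < L) {n m : ℕ} (hnm : n ≤ m) (hm : m ≤ T) :
    (∑ j ∈ Finset.range m, stepWeight η j)
        * ∫ u, ‖wrapperIterate K z₁ η r δ τ f u m - wrapperIterate K z₁ η r δ τ f u n‖
          ∂(directionLaw k T)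
      ≤ L ^ 2 / G + 2 * G * (m - n : ℝ) + ∑ j ∈ Finset.Ico n m, stepWeight η j
        * ∫ u, ‖wrapperIterate K z₁ η r δ τ f u j - wrapperIterate K z₁ η r δ τ f u n‖
          ∂(directionLaw k T) := by
  have hdrift := H.integrable_drift τ n
  have hloss : Integrable (fun u => ‖∑ j ∈ Finset.Ico n m,
      observedLoss (pftrl K z₁ η) r δ τ f u j‖) (directionLaw k T) :=
    integrable_of_continuous_of_compactSpace
      (continuous_finsetSum _ fun j _ => H.continuous_observedLoss τ j).norm
  have hsum : Integrable (fun u => ∑ j ∈ Finset.Ico n m, stepWeight η j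
      * ‖wrapperIterate K z₁ η r δ τ f u j - wrapperIterate K z₁ η r δ τ f u n‖)
      (directionLaw k T) := integrable_finsetSum _ fun j _ => (hdrift j).const_mul _
  have hmono := integral_mono ((hdrift m).const_mul _) (hloss.add hsum) fun u =>
    (H.isProximalFTRL τ u).mul_norm_sub_le H.weight_nonneg hnm
  simp only [Pi.add_apply] at hmono
  rw [integral_const_mul, integral_add hloss hsum,
    integral_finsetSum _ fun j _ => (hdrift j).const_mul _] at hmono
  simp only [integral_const_mul] at hmono
  linarith [H.integral_norm_sum_observedLoss_le τ hL hL0 hnm hm]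

lemma integral_drift_le (hL0 : 0 < L) {n m : ℕ} (hnm : n ≤ m) (hm : m ≤ T) :
    ∫ u, ‖wrapperIterate K z₁ η r δ τ f u m - wrapperIterate K z₁ η r δ τ f u n‖
        ∂(directionLaw k T)
      ≤ L ^ 2 / G * η (n + 1) + ∑ j ∈ Finset.Ico n m, 2 * G * η (j + 1) := by
  have hbound := le_driftBound_of_recursion (β := stepWeight η) (a := L ^ 2 / G) (b := 2 * G)
    (W := fun j => ∫ u, ‖wrapperIterate K z₁ η r δ τ f u j - wrapperIterate K z₁ η r δ τ f u n‖
      ∂(directionLaw k T)) H.weight_nonneg (by positivity) (by positivity)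
    (fun j _ => H.sum_range_stepWeight_pos j) (by simp)
    (fun j hnj hj => H.mul_integral_drift_le τ hL hL0 hnj.le hj) hnm hm
  simpa only [driftBound, sum_stepWeight, div_div_eq_mul_div, div_one] using hbound

end Drift

section RegretDecomposition

omit [NeZero k] in
lemma linear_regret_le [NeZero T] (u : Fin T → USphere k) {x : Eucl k} (hx : x ∈ K) :
    ∑ t, ⟪wrapperLoss (pftrl K z₁ η) r δ τ f u t,
        wrapperIterate K z₁ η r δ τ f u (τ.obsPos t) - x⟫
      ≤ linearRegretBound k η δ τ D M := by
  set z := wrapperIterate K z₁ η r δ τ f u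
  set c := observedLoss (pftrl K z₁ η) r δ τ f u
  have hreindex : ∑ t, ⟪wrapperLoss (pftrl K z₁ η) r δ τ f u t, z (τ.obsPos t) - x⟫
      = ∑ n ∈ Finset.range T, ⟪c n, z n - x⟫ := by
    rw [← Fin.sum_univ_eq_sum_range (fun n => ⟪c n, z n - x⟫) T, ← Equiv.sum_comp τ.obsOrder]
    simp only [c, observedLoss_coe, τ.obsPos_obsOrder]
  have hproximal : ∑ n ∈ Finset.range T, stepWeight η n * ‖z n - x‖ ^ 2 / 2
      ≤ D ^ 2 / (2 * η T) := by
    obtain ⟨N, hN⟩ := Nat.exists_eq_succ_of_ne_zero (NeZero.ne T)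
    calc _ ≤ ∑ n ∈ Finset.range T, stepWeight η n * (D ^ 2 / 2) := by
          refine Finset.sum_le_sum fun n _ => ?_
          rw [mul_div_assoc]
          have := H.weight_nonneg n
          have := H.diam_le _ (H.iterate_mem τ u n) _ hx
          gcongr
      _ = D ^ 2 / (2 * η T) := by
          rw [← Finset.sum_mul, hN, Nat.succ_eq_add_one, sum_stepWeight]
          ring
  have hstability : ∑ n ∈ Finset.range T, ‖c n‖ ^ 2
        / (2 * ∑ m ∈ Finset.range (n + 1), stepWeight η m)
      ≤ ∑ m : Fin T, η ((m : ℕ) + 1) * (k * M / δ ((τ.obsOrder m : ℕ) + 1)) ^ 2 / 2 := by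
    rw [← Fin.sum_univ_eq_sum_range fun n =>
      ‖c n‖ ^ 2 / (2 * ∑ m ∈ Finset.range (n + 1), stepWeight η m)]
    refine Finset.sum_le_sum fun m _ => ?_
    have hrate := H.rate_pos m
    have hloss := H.norm_loss_le τ u (τ.obsOrder m)
    simp only [c, observedLoss_coe, sum_stepWeight]
    calc _ = η ((m : ℕ) + 1) * ‖wrapperLoss (pftrl K z₁ η) r δ τ f u (τ.obsOrder m)‖ ^ 2 / 2 := by
          field_simp
      _ ≤ _ := by gcongr
  rw [hreindex]
  exact ((H.isProximalFTRL τ u).regret_le T (fun n _ => H.sum_range_stepWeight_pos n) hx).trans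
    (add_le_add hproximal hstability)

lemma integral_sum_inner_meanLoss_le [NeZero T] {x : Eucl k} (hx : x ∈ K) :
    ∑ t, ∫ u, ⟪wrapperMeanLoss K z₁ η r δ τ f u t,
        wrapperIterate K z₁ η r δ τ f u (τ.obsPos t) - x⟫ ∂(directionLaw k T)
      ≤ linearRegretBound k η δ τ D M := by
  have hcont : ∀ t, Continuous fun u => wrapperIterate K z₁ η r δ τ f u (τ.obsPos t) - x :=
    fun t => (H.continuous_iterate τ _).sub continuous_const
  have hint : ∀ t, Integrable (fun u => ⟪wrapperLoss (pftrl K z₁ η) r δ τ f u t,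
      wrapperIterate K z₁ η r δ τ f u (τ.obsPos t) - x⟫) (directionLaw k T) := fun t =>
    integrable_of_continuous_of_compactSpace ((H.continuous_loss τ t).inner (hcont t))
  calc _ = ∑ t, ∫ u, ⟪wrapperLoss (pftrl K z₁ η) r δ τ f u t,
        wrapperIterate K z₁ η r δ τ f u (τ.obsPos t) - x⟫ ∂(directionLaw k T) :=
        Finset.sum_congr rfl fun t _ => (H.integral_inner_loss τ t (hcont t)
          fun u v => by rw [wrapperIterate_update le_rfl]).symm
    _ = ∫ u, ∑ t, ⟪wrapperLoss (pftrl K z₁ η) r δ τ f u t,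
        wrapperIterate K z₁ η r δ τ f u (τ.obsPos t) - x⟫ ∂(directionLaw k T) :=
        (integral_finsetSum _ fun t _ => hint t).symm
    _ ≤ linearRegretBound k η δ τ D M := by
        simpa using integral_mono (integrable_finsetSum _ fun t _ => hint t)
          (integrable_const (linearRegretBound k η δ τ D M))
          fun u => H.linear_regret_le τ u hx

lemma round_regret_le_of_drift (u : Fin T → USphere k) (t : Fin T) {x : Eucl k} (hx : x ∈ K) :
    f t (wrapperPred (pftrl K z₁ η) r δ τ f u t) - f t x
      ≤ 7 * (G * D) * (δ ((t : ℕ) + 1) / r)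
        + ⟪wrapperMeanLoss K z₁ η r δ τ f u t,
            wrapperIterate K z₁ η r δ τ f u (τ.obsPos t) - x⟫
        + G * ‖wrapperIterate K z₁ η r δ τ f u (τ.obsPos t)
            - wrapperIterate K z₁ η r δ τ f u (τ.seen t)‖ := by
  set g := wrapperMeanLoss K z₁ η r δ τ f u t
  set z := wrapperIterate K z₁ η r δ τ f u
  have hsplit : ⟪g, z (τ.seen t) - x⟫
      = ⟪g, z (τ.obsPos t) - x⟫ + ⟪g, z (τ.seen t) - z (τ.obsPos t)⟫ := by
    rw [← inner_add_right, sub_add_sub_cancel']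
  have hdrift : ⟪g, z (τ.seen t) - z (τ.obsPos t)⟫ ≤ G * ‖z (τ.obsPos t) - z (τ.seen t)‖ := by
    rw [norm_sub_rev]
    exact (real_inner_le_norm _ _).trans
      (mul_le_mul_of_nonneg_right (H.norm_meanLoss_le τ u t) (norm_nonneg _))
  linarith [H.round_regret_le τ u t hx]

lemma integral_regret_le [NeZero T] {L : ℝ} (hL : ∀ t : Fin T, k * M / δ ((t : ℕ) + 1) ≤ L)
    (hL0 : 0 < L) {x : Eucl k} (hx : x ∈ K) :
    ∫ u, wrapperRegret (pftrl K z₁ η) r δ τ f u x ∂(directionLaw k T)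
      ≤ ∑ t : Fin T, 7 * (G * D) * (δ ((t : ℕ) + 1) / r) + linearRegretBound k η δ τ D M
        + ∑ t : Fin T, G * min D (L ^ 2 / G * η (τ.seen t + 1)
            + ∑ j ∈ Finset.Ico (τ.seen t) (τ.obsPos t), 2 * G * η (j + 1)) := by
  have hinner : ∀ t, Integrable (fun u => ⟪wrapperMeanLoss K z₁ η r δ τ f u t,
      wrapperIterate K z₁ η r δ τ f u (τ.obsPos t) - x⟫) (directionLaw k T) := fun t =>
    integrable_of_continuous_of_compactSpace <|
      (H.continuous_meanLoss τ t).inner ((H.continuous_iterate τ _).sub continuous_const)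
  have hbias := fun t : Fin T =>
    (integrable_const (μ := directionLaw k T) (7 * (G * D) * (δ ((t : ℕ) + 1) / r))).add (hinner t)
  have hdrift := fun t => (H.integrable_drift τ (τ.seen t) (τ.obsPos t)).const_mul (G : ℝ)
  refine (integral_mono (H.integrable_regret τ x)
    (integrable_finsetSum _ fun t _ => (hbias t).add (hdrift t))
    fun u => Finset.sum_le_sum fun t _ => H.round_regret_le_of_drift τ u t hx).trans ?_
  rw [integral_finsetSum _ fun t _ => (hbias t).add (hdrift t)]
  simp only [integral_add' (hbias _) (hdrift _), integral_add' (integrable_const _) (hinner _),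
    integral_const_mul, integral_const, probReal_univ, one_smul, Finset.sum_add_distrib]
  gcongr with t
  · exact H.integral_sum_inner_meanLoss_le τ hx
  · exact le_min (H.integral_drift_le_diam τ _ _)
      (H.integral_drift_le τ hL hL0 (τ.seen_le_obsPos t) (τ.obsPos t).2.le)

end RegretDecomposition

end WrapperAssumptions

/-! ### Elementary sums -/

-- Bernoulli's inequality `(1 - 1/(n+1))^{1-p} ≤ 1 - (1-p)/(n+1)` bounds each term by a telescoping
-- difference.
lemma sum_rpow_neg_le {p : ℝ} (hp0 : 0 ≤ p) (hp1 : p < 1) (T : ℕ) :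
    ∑ t : Fin T, (((t : ℕ) : ℝ) + 1) ^ (-p) ≤ (T : ℝ) ^ (1 - p) / (1 - p) := by
  rw [Fin.sum_univ_eq_sum_range (fun t => ((t : ℝ) + 1) ^ (-p)) T]
  have hq : 0 < 1 - p := by linarith
  induction T with
  | zero => simp [Real.zero_rpow hq.ne']
  | succ n ih =>
    have hn : (0 : ℝ) < (n : ℝ) + 1 := by positivity
    have hpow : 0 < ((n : ℝ) + 1) ^ (1 - p) := Real.rpow_pos_of_pos hn _
    have hbernoulli := rpow_one_add_le_one_add_mul_self (s := -(1 / ((n : ℝ) + 1))) (p := 1 - p)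
      (by rw [neg_le_neg_iff, div_le_one hn]; linarith [Nat.cast_nonneg (α := ℝ) n])
      hq.le (by linarith)
    have hratio : 1 + -(1 / ((n : ℝ) + 1)) = n / (n + 1) := by field_simp; ring
    rw [hratio, Real.div_rpow n.cast_nonneg hn.le, div_le_iff₀ hpow] at hbernoulli
    have hterm : ((n : ℝ) + 1) ^ (-p) = ((n : ℝ) + 1) ^ (1 - p) / (n + 1) := by
      rw [← Real.rpow_sub_one hn.ne', sub_sub_cancel_left]
    have hstep : (n : ℝ) ^ (1 - p) ≤ ((n : ℝ) + 1) ^ (1 - p)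
        - (1 - p) * ((n : ℝ) + 1) ^ (-p) := by
      rw [hterm]
      refine hbernoulli.trans_eq ?_
      ring
    rw [Finset.sum_range_succ, Nat.cast_succ, le_div_iff₀ hq]
    rw [le_div_iff₀ hq] at ih
    linarith

lemma div_sqrt_le_two_mul_sub {S x y : ℝ} (hS : 0 ≤ S) (hx : 0 ≤ x) (hy : S + x ≤ y) :
    x / √y ≤ 2 * (√(S + x) - √S) := by
  rcases hx.eq_or_lt with rfl | hx
  · simp
  have hpos : 0 < √(S + x) := Real.sqrt_pos.2 (by linarith)
  have hmono : √S ≤ √(S + x) := Real.sqrt_le_sqrt (by linarith)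
  have hfactor : (√(S + x) - √S) * (√(S + x) + √S) = x := by
    linarith [Real.mul_self_sqrt hS, Real.mul_self_sqrt (by linarith : 0 ≤ S + x)]
  calc x / √y ≤ x / √(S + x) := by gcongr
    _ ≤ 2 * (√(S + x) - √S) := by
        rw [div_le_iff₀ hpos]
        nlinarith

lemma sum_div_sqrt_le {T : ℕ} {x y : Fin T → ℝ} (hx : ∀ m, 0 ≤ x m)
    (hy : ∀ m, ∑ j with j ≤ m, x j ≤ y m) :
    ∑ m, x m / √(y m) ≤ 2 * √(∑ m, x m) := by
  simp only [Finset.sum_filter] at hy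
  induction T with
  | zero => simp
  | succ n ih =>
    have hinit := ih (x := fun m => x m.castSucc) (y := fun m => y m.castSucc) (fun m => hx _)
      fun m => by
        have := hy m.castSucc
        rw [Fin.sum_univ_castSucc] at this
        simpa [Fin.not_le.2 (Fin.castSucc_lt_last m)] using this
    have hlast := hy (Fin.last n)
    simp only [Fin.le_last, if_true, Fin.sum_univ_castSucc] at hlast
    rw [Fin.sum_univ_castSucc, Fin.sum_univ_castSucc (f := x)]
    linarith [div_sqrt_le_two_mul_sub (Finset.sum_nonneg fun m _ => hx (Fin.castSucc m))
      (hx (Fin.last n)) hlast]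

lemma mul_sqrt_div_two_le_sum_sqrt (n : ℕ) :
    (n : ℝ) * √n / 2 ≤ ∑ m ∈ Finset.range n, √((m : ℝ) + 1) := by
  induction n with
  | zero => simp
  | succ n ih =>
    rw [Finset.sum_range_succ, Nat.cast_succ]
    have hmono : √(n : ℝ) ≤ √((n : ℝ) + 1) := Real.sqrt_le_sqrt (by linarith)
    have hsq := Real.mul_self_sqrt (Nat.cast_nonneg (α := ℝ) n)
    have hsq' := Real.mul_self_sqrt (by positivity : (0 : ℝ) ≤ (n : ℝ) + 1)
    set a := √(n : ℝ)
    set b := √((n : ℝ) + 1)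
    have ha : 0 ≤ a := Real.sqrt_nonneg _
    have hgap : a * (b - a) ≤ 1 := by nlinarith
    have hcube : a * (a * (b - a)) ≤ b := by nlinarith
    rw [← hsq] at ih hsq' ⊢
    rw [← hsq']
    nlinarith

lemma card_mul_card_add_one_le {T : ℕ} (U : Finset (Fin T)) :
    U.card * (U.card + 1) ≤ 2 * ∑ t ∈ U, ((t : ℕ) + 1) := by
  induction U using Finset.induction_on_max with
  | empty => simp
  | insert a U ha ih =>
    have haU : a ∉ U := fun h => lt_irrefl a (ha a h)
    have hcard : U.card ≤ a := by
      simpa using Finset.card_le_card fun t ht => Finset.mem_Iio.2 (ha t ht)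
    rw [Finset.card_insert_of_notMem haU, Finset.sum_insert haU]
    nlinarith

-- The missing feedback `t - seen t` sums to the total delay, and exceeds `t / 2` on this set.
lemma Timeline.card_filter_two_mul_seen_lt_le {T : ℕ} (τ : Timeline T) :
    ((Finset.univ.filter fun t : Fin T => 2 * τ.seen t < t).card : ℝ)
      ≤ 2 * √(τ.totalDelay : ℝ) := by
  set U := Finset.univ.filter fun t : Fin T => 2 * τ.seen t < t
  have hmissing : ∑ t : Fin T, ((t : ℕ) - τ.seen t) = τ.totalDelay := by
    rw [Finset.sum_tsub_distrib _ fun t _ => τ.seen_le t, ← τ.sum_seen_add_totalDelay]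
    lia
  have hsum : ∑ t ∈ U, ((t : ℕ) + 1) ≤ 2 * τ.totalDelay := by
    rw [← hmissing, Finset.mul_sum]
    calc _ ≤ ∑ t ∈ U, 2 * ((t : ℕ) - τ.seen t) := by
          refine Finset.sum_le_sum fun t ht => ?_
          have := (Finset.mem_filter.1 ht).2
          lia
      _ ≤ _ := Finset.sum_le_sum_of_subset (Finset.subset_univ _)
  have hcard : U.card ^ 2 ≤ 2 ^ 2 * τ.totalDelay := by
    have := card_mul_card_add_one_le U
    nlinarith
  calc (U.card : ℝ) ≤ √(2 ^ 2 * τ.totalDelay) := Real.le_sqrt_of_sq_le (by exact_mod_cast hcard)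
    _ = 2 * √(τ.totalDelay : ℝ) := by
        rw [Real.sqrt_mul (by positivity), Real.sqrt_sq zero_le_two]

lemma rpow_one_quarter_pow_two {x : ℝ} (hx : 0 ≤ x) : (x ^ (1 / 4 : ℝ)) ^ 2 = √x := by
  rw [Real.sqrt_eq_rpow, ← Real.rpow_mul_natCast hx]
  norm_num

lemma rpow_one_quarter_pow_three {x : ℝ} (hx : 0 ≤ x) :
    (x ^ (1 / 4 : ℝ)) ^ 3 = x ^ (3 / 4 : ℝ) := by
  rw [← Real.rpow_mul_natCast hx]
  norm_num

lemma rpow_one_quarter_pow_four {x : ℝ} (hx : 0 ≤ x) : (x ^ (1 / 4 : ℝ)) ^ 4 = x := by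
  rw [← Real.rpow_mul_natCast hx]
  norm_num

lemma sqrt_add_add_le {x y z : ℝ} (hx : 0 ≤ x) (hy : 0 ≤ y) (hz : 0 ≤ z) :
    √(x + y + z) ≤ √x + √y + √z := by
  refine Real.sqrt_le_iff.2 ⟨by positivity, ?_⟩
  have hcross : 0 ≤ √x * √y + √x * √z + √y * √z := by positivity
  nlinarith [Real.sq_sqrt hx, Real.sq_sqrt hy, Real.sq_sqrt hz]

/-! ### Learning rates -/

section LearningRates

variable {T : ℕ} (k : ℕ) (D G r ν : ℝ) (δ : ℕ → ℝ) (τ : Timeline T)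

/-- The scale `ν k r / δ'_m` of the `m`-th observed gradient estimate, in units of `G`. -/
noncomputable def lossScale (m : Fin T) : ℝ :=
  ν * k * r / δ ((τ.obsOrder m : ℕ) + 1 + τ.delay (τ.obsOrder m))

/-- The number `S_n` in `η_n = (D/G) / √S_n`. -/
noncomputable def rateSum (n : ℕ) : ℝ :=
  (n : ℝ) + ∑ m ∈ Finset.univ.filter (fun m : Fin T => (m : ℕ) + 1 ≤ n),
    ((τ.dualBacklog (τ.obsOrder m) : ℝ) + lossScale k r ν δ τ m ^ 2)

lemma learningRate_eq (n : ℕ) :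
    learningRate k D G r ν δ τ n = (D / G) / √(rateSum k r ν δ τ n) := rfl

lemma rateSum_mono : Monotone (rateSum k r ν δ τ) := by
  intro m n hmn
  refine add_le_add (Nat.cast_le.2 hmn)
    (Finset.sum_le_sum_of_subset_of_nonneg (fun j hj => ?_) fun _ _ _ => by positivity)
  simp only [Finset.mem_filter, Finset.mem_univ, true_and] at hj ⊢
  lia

lemma rateSum_succ_pos (n : ℕ) : 0 < rateSum k r ν δ τ (n + 1) :=
  add_pos_of_pos_of_nonneg (by positivity) (Finset.sum_nonneg fun _ _ => by positivity)

lemma rateSum_card : rateSum k r ν δ τ T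
    = T + τ.totalDelay + ∑ m, lossScale k r ν δ τ m ^ 2 := by
  have hbacklog : ∑ m, (τ.dualBacklog (τ.obsOrder m) : ℝ) = τ.totalDelay := by
    rw [Equiv.sum_comp τ.obsOrder fun t => (τ.dualBacklog t : ℝ), ← Nat.cast_sum,
      τ.sum_dualBacklog]
  rw [rateSum, Finset.filter_true_of_mem fun m _ => m.2, Finset.sum_add_distrib, hbacklog,
    add_assoc]

variable {D G}

lemma learningRate_succ_pos (hD : 0 < D) (hG : 0 < G) (n : ℕ) :
    0 < learningRate k D G r ν δ τ (n + 1) :=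
  div_pos (div_pos hD hG) (Real.sqrt_pos.2 (rateSum_succ_pos k r ν δ τ n))

lemma stepWeight_learningRate_nonneg (hD : 0 < D) (hG : 0 < G) :
    ∀ n, 0 ≤ stepWeight (learningRate k D G r ν δ τ) n
  | 0 => (one_div_pos.2 (learningRate_succ_pos k r ν δ τ hD hG 0)).le
  | n + 1 => by
    refine sub_nonneg.2 (one_div_le_one_div_of_le (learningRate_succ_pos k r ν δ τ hD hG _) ?_)
    rw [learningRate_eq, learningRate_eq]
    have hpos := rateSum_succ_pos k r ν δ τ n
    have hmono := rateSum_mono k r ν δ τ (n + 1).le_succ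
    gcongr

lemma sum_mul_learningRate_le (hD : 0 < D) (hG : 0 < G) {x : Fin T → ℝ} (hx0 : ∀ m, 0 ≤ x m)
    (hx : ∀ m, x m ≤ τ.dualBacklog (τ.obsOrder m) + lossScale k r ν δ τ m ^ 2) :
    ∑ m, x m * learningRate k D G r ν δ τ ((m : ℕ) + 1) ≤ D / G * (2 * √(∑ m, x m)) := by
  have hpartial : ∀ m, ∑ j with j ≤ m, x j ≤ rateSum k r ν δ τ ((m : ℕ) + 1) := fun m => by
    simp only [rateSum, add_le_add_iff_right, Fin.val_fin_le]
    exact le_add_of_nonneg_of_le (Nat.cast_nonneg _) (Finset.sum_le_sum fun j _ => hx j)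
  calc _ = D / G * ∑ m, x m / √(rateSum k r ν δ τ ((m : ℕ) + 1)) := by
        rw [Finset.mul_sum]
        exact Finset.sum_congr rfl fun m _ => by rw [learningRate_eq]; ring
    _ ≤ _ := by
        gcongr
        exact sum_div_sqrt_le hx0 hpartial

lemma sum_dualBacklog_mul_learningRate_le (hD : 0 < D) (hG : 0 < G) :
    ∑ m, (τ.dualBacklog (τ.obsOrder m) : ℝ) * learningRate k D G r ν δ τ ((m : ℕ) + 1)
      ≤ D / G * (2 * √(τ.totalDelay : ℝ)) := by
  refine (sum_mul_learningRate_le k r ν δ τ hD hG (fun _ => Nat.cast_nonneg _)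
    fun _ => le_add_of_nonneg_right (sq_nonneg _)).trans_eq ?_
  rw [Equiv.sum_comp τ.obsOrder fun t => (τ.dualBacklog t : ℝ), ← Nat.cast_sum, τ.sum_dualBacklog]

lemma sum_lossScale_sq_mul_learningRate_le (hD : 0 < D) (hG : 0 < G) :
    ∑ m, lossScale k r ν δ τ m ^ 2 * learningRate k D G r ν δ τ ((m : ℕ) + 1)
      ≤ D / G * (2 * √(∑ m, lossScale k r ν δ τ m ^ 2)) :=
  sum_mul_learningRate_le k r ν δ τ hD hG (fun _ => sq_nonneg _)
    fun _ => le_add_of_nonneg_left (Nat.cast_nonneg _)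

end LearningRates

/-! ### Smoothing schedules -/

section Schedules

variable {T k : ℕ} {r ν : ℝ} {δ : ℕ → ℝ}

/-- What the analysis uses of `roundSchedule` and `fixedSchedule`: in the rounds `1, …, T` the
smoothing is positive, nonincreasing and at most `r min {1, √(νk) / t^{1/4}}`, and in the regime
`νk ≤ √T` it is at least `r √(νk) / T^{1/4}`. -/
structure IsSmoothingSchedule (T k : ℕ) (r ν : ℝ) (δ : ℕ → ℝ) : Prop where
  pos : ∀ t, 1 ≤ t → t ≤ T → 0 < δ t
  le : ∀ t, δ t ≤ r
  anti : ∀ s t, 1 ≤ s → s ≤ t → δ t ≤ δ s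
  upper : ∀ t, 1 ≤ t → t ≤ T → δ t ≤ r * (√(ν * k) / (t : ℝ) ^ (1 / 4 : ℝ))
  lower : ν * k ≤ √T → ∀ t, 1 ≤ t → t ≤ T → r * (√(ν * k) / (T : ℝ) ^ (1 / 4 : ℝ)) ≤ δ t

lemma sqrt_div_rpow_one_quarter_le_one {N x : ℝ} (hx : 0 < x) (h : N ≤ √x) :
    √N / x ^ (1 / 4 : ℝ) ≤ 1 := by
  rw [div_le_one (Real.rpow_pos_of_pos hx _), Real.sqrt_le_left (by positivity),
    rpow_one_quarter_pow_two hx.le]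
  exact h

lemma isSmoothingSchedule_roundSchedule (hr : 0 < r) (hN : 0 < ν * k) :
    IsSmoothingSchedule T k r ν (roundSchedule k r ν) where
  pos t ht _ := by
    have : (0 : ℝ) < t := by exact_mod_cast ht
    unfold roundSchedule
    positivity
  le t := mul_le_of_le_one_right hr.le (min_le_left _ _)
  anti s t hs hst := by
    have : (0 : ℝ) < s := by exact_mod_cast hs
    unfold roundSchedule
    gcongr
  upper t _ _ := mul_le_mul_of_nonneg_left (min_le_right _ _) hr.le
  lower h t ht htT := by
    have : (0 : ℝ) < t := by exact_mod_cast ht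
    have hT : (0 : ℝ) < T := by exact_mod_cast ht.trans htT
    refine mul_le_mul_of_nonneg_left (le_min (sqrt_div_rpow_one_quarter_le_one hT h) ?_) hr.le
    gcongr

lemma isSmoothingSchedule_fixedSchedule (hr : 0 < r) (hN : 0 < ν * k) :
    IsSmoothingSchedule T k r ν (fixedSchedule k T r ν) where
  pos t ht htT := by
    have : (0 : ℝ) < T := by exact_mod_cast ht.trans htT
    unfold fixedSchedule
    positivity
  le _ := mul_le_of_le_one_right hr.le (min_le_left _ _)
  anti s t _ _ := le_rfl
  upper t ht htT := by
    have : (0 : ℝ) < t := by exact_mod_cast ht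
    refine mul_le_mul_of_nonneg_left ((min_le_right _ _).trans ?_) hr.le
    gcongr
  lower h _ ht htT := by
    have hT : (0 : ℝ) < T := by exact_mod_cast ht.trans htT
    exact mul_le_mul_of_nonneg_left (le_min (sqrt_div_rpow_one_quarter_le_one hT h) le_rfl) hr.le

lemma sq_mul_div_schedule {N x : ℝ} (hN : 0 < N) (hr : 0 < r) (hx : 0 < x) :
    (N * r / (r * (√N / x ^ (1 / 4 : ℝ)))) ^ 2 = N * √x := by
  have hcancel : N * r / (r * (√N / x ^ (1 / 4 : ℝ))) = √N * x ^ (1 / 4 : ℝ) := by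
    field_simp
    exact (Real.sq_sqrt hN.le).symm
  rw [hcancel, mul_pow, Real.sq_sqrt hN.le, rpow_one_quarter_pow_two hx.le]

namespace IsSmoothingSchedule

variable (hδ : IsSmoothingSchedule T k r ν δ) (hr : 0 < r) (hN : 0 < ν * k) (τ : Timeline T)

include hδ hr

lemma sum_div_le : ∑ t : Fin T, δ ((t : ℕ) + 1) / r
    ≤ 4 / 3 * ((T : ℝ) ^ (3 / 4 : ℝ) * √(ν * k)) := by
  have hterm : ∀ t : Fin T,
      δ ((t : ℕ) + 1) / r ≤ √(ν * k) * (((t : ℕ) : ℝ) + 1) ^ (-(1 / 4) : ℝ) := fun t => by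
    rw [div_le_iff₀ hr, Real.rpow_neg (by positivity)]
    refine (hδ.upper ((t : ℕ) + 1) (by lia) t.2).trans_eq ?_
    push_cast
    ring
  calc _ ≤ √(ν * k) * ∑ t : Fin T, (((t : ℕ) : ℝ) + 1) ^ (-(1 / 4) : ℝ) := by
        rw [Finset.mul_sum]
        exact Finset.sum_le_sum fun t _ => hterm t
    _ ≤ √(ν * k) * ((T : ℝ) ^ (1 - 1 / 4 : ℝ) / (1 - 1 / 4)) := by
        gcongr
        exact sum_rpow_neg_le (by norm_num) (by norm_num) T
    _ = _ := by norm_num; ring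

include hN

lemma lossScale_sq_le (hNT : ν * k ≤ √T) (m : Fin T) :
    lossScale k r ν δ τ m ^ 2 ≤ ν * k * √T := by
  have hT : (0 : ℝ) < T := by exact_mod_cast m.pos
  have hround := τ.add_delay_lt (τ.obsOrder m)
  have hlower := hδ.lower hNT ((τ.obsOrder m : ℕ) + 1 + τ.delay (τ.obsOrder m)) (by lia) (by lia)
  have hpos := hδ.pos ((τ.obsOrder m : ℕ) + 1 + τ.delay (τ.obsOrder m)) (by lia) (by lia)
  rw [← sq_mul_div_schedule hN hr hT, lossScale]
  gcongr

-- The `m`-th observation arrives no earlier than round `m`.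
lemma le_lossScale_sq (m : Fin T) : ν * k * √((m : ℝ) + 1) ≤ lossScale k r ν δ τ m ^ 2 := by
  have hround := τ.add_delay_lt (τ.obsOrder m)
  have hback := τ.dualBacklog_add_obsPos (τ.obsOrder m)
  rw [τ.obsPos_obsOrder] at hback
  set j := (τ.obsOrder m : ℕ) + 1 + τ.delay (τ.obsOrder m) with hj
  have hmj : (m : ℝ) + 1 ≤ j := by exact_mod_cast (by lia : (m : ℕ) + 1 ≤ j)
  have hj0 : (0 : ℝ) < j := lt_of_lt_of_le (by positivity) hmj
  have hupper := hδ.upper j (by lia) (by lia)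
  have hpos := hδ.pos j (by lia) (by lia)
  calc ν * k * √((m : ℝ) + 1) ≤ ν * k * √(j : ℝ) := by gcongr
    _ ≤ _ := by
      rw [← sq_mul_div_schedule hN hr hj0, lossScale, ← hj]
      gcongr

lemma le_rateSum {n : ℕ} (hn : n ≤ T) : ν * k * (n * √n / 2) ≤ rateSum k r ν δ τ n := by
  have hreindex : ∑ m ∈ Finset.range n, ν * k * √((m : ℝ) + 1)
      = ∑ m ∈ Finset.univ.filter (fun m : Fin T => (m : ℕ) + 1 ≤ n),
          ν * k * √(((m : ℕ) : ℝ) + 1) := by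
    have hrange : Finset.range n = (Finset.range T).filter fun m => m + 1 ≤ n := by
      ext m
      simp only [Finset.mem_filter, Finset.mem_range]
      lia
    rw [hrange, Finset.sum_filter, Finset.sum_filter, ← Fin.sum_univ_eq_sum_range
      (fun m => if m + 1 ≤ n then ν * k * √((m : ℝ) + 1) else 0) T]
  calc ν * k * (n * √n / 2) ≤ ν * k * ∑ m ∈ Finset.range n, √((m : ℝ) + 1) := by
        gcongr
        exact mul_sqrt_div_two_le_sum_sqrt n
    _ = _ := by rw [Finset.mul_sum, hreindex]
    _ ≤ _ := le_add_of_nonneg_of_le (Nat.cast_nonneg _) <| Finset.sum_le_sum fun m _ =>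
        le_add_of_nonneg_of_le (Nat.cast_nonneg _) (hδ.le_lossScale_sq hr hN τ m)

lemma sqrt_mul_rpow_le_sqrt_rateSum {t : Fin T} (ht : (t : ℕ) ≤ 2 * τ.seen t) :
    √(ν * k) * ((t : ℝ) + 1) ^ (3 / 4 : ℝ) ≤ 3 * √(rateSum k r ν δ τ (τ.seen t + 1)) := by
  have hseen := τ.seen_le t
  have hrate := hδ.le_rateSum hr hN τ (n := τ.seen t + 1) (by lia)
  have hx : (0 : ℝ) < (t : ℝ) + 1 := by positivity
  set n : ℝ := ((τ.seen t + 1 : ℕ) : ℝ) with hn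
  have hn0 : 0 < n := by positivity
  have hxn : (t : ℝ) + 1 ≤ 2 * n := by
    rw [hn]
    exact_mod_cast (by lia : (t : ℕ) + 1 ≤ 2 * (τ.seen t + 1))
  have hsqrt : √((t : ℝ) + 1) ≤ 2 * √n := by
    refine Real.sqrt_le_iff.2 ⟨by positivity, ?_⟩
    rw [mul_pow, Real.sq_sqrt hn0.le]
    linarith
  have hpow : (((t : ℝ) + 1) ^ (3 / 4 : ℝ)) ^ 2 = ((t : ℝ) + 1) * √((t : ℝ) + 1) := by
    rw [Real.sqrt_eq_rpow, ← Real.rpow_mul_natCast hx.le, ← Real.rpow_one_add' hx.le (by norm_num)]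
    norm_num
  calc √(ν * k) * ((t : ℝ) + 1) ^ (3 / 4 : ℝ)
      ≤ √(3 ^ 2 * rateSum k r ν δ τ (τ.seen t + 1)) := by
        refine Real.le_sqrt_of_sq_le ?_
        rw [mul_pow, Real.sq_sqrt hN.le, hpow]
        calc ν * k * (((t : ℝ) + 1) * √((t : ℝ) + 1)) ≤ ν * k * (2 * n * (2 * √n)) := by gcongr
          _ = 8 * (ν * k * (n * √n / 2)) := by ring
          _ ≤ 3 ^ 2 * rateSum k r ν δ τ (τ.seen t + 1) := by
              linarith [rateSum_succ_pos k r ν δ τ (τ.seen t)]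
    _ = _ := by rw [Real.sqrt_mul (by norm_num), Real.sqrt_sq (by norm_num)]

lemma sqrt_sum_lossScale_sq_le (hNT : ν * k ≤ √T) :
    √(∑ m, lossScale k r ν δ τ m ^ 2) ≤ (T : ℝ) ^ (3 / 4 : ℝ) * √(ν * k) := by
  have hT : (0 : ℝ) ≤ T := T.cast_nonneg
  refine Real.sqrt_le_iff.2 ⟨by positivity, ?_⟩
  calc ∑ m, lossScale k r ν δ τ m ^ 2 ≤ ∑ _m : Fin T, ν * k * √T :=
        Finset.sum_le_sum fun m _ => hδ.lossScale_sq_le hr hN τ hNT m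
    _ = T * (ν * k * √T) := by simp
    _ = ((T : ℝ) ^ (3 / 4 : ℝ) * √(ν * k)) ^ 2 := by
        rw [mul_pow, Real.sq_sqrt hN.le, ← rpow_one_quarter_pow_three hT,
          ← rpow_one_quarter_pow_two hT]
        nth_rw 1 [← rpow_one_quarter_pow_four hT]
        ring

lemma sqrt_rateSum_le (hNT : ν * k ≤ √T) (hNT' : 1 ≤ ν * k * √T) :
    √(rateSum k r ν δ τ T)
      ≤ √(τ.totalDelay : ℝ) + 2 * ((T : ℝ) ^ (3 / 4 : ℝ) * √(ν * k)) := by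
  have hT : (0 : ℝ) ≤ T := T.cast_nonneg
  have hsqrtT : √(T : ℝ) ≤ (T : ℝ) ^ (3 / 4 : ℝ) * √(ν * k) := by
    have hq : 0 ≤ (T : ℝ) ^ (1 / 4 : ℝ) := by positivity
    rw [← rpow_one_quarter_pow_two hT] at hNT' ⊢
    rw [← rpow_one_quarter_pow_three hT, pow_succ _ 2, mul_assoc]
    refine le_mul_of_one_le_right (sq_nonneg _) ?_
    rwa [← one_le_sq_iff₀ (by positivity), mul_pow, Real.sq_sqrt hN.le, mul_comm]
  rw [rateSum_card]
  refine (sqrt_add_add_le hT τ.totalDelay.cast_nonneg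
    (Finset.sum_nonneg fun _ _ => sq_nonneg _)).trans ?_
  linarith [hδ.sqrt_sum_lossScale_sq_le hr hN τ hNT]

end IsSmoothingSchedule

end Schedules

/-! ### The regret bound -/

section Tuning

variable {k T : ℕ} {D G r ν : ℝ} {δ : ℕ → ℝ}

namespace IsSmoothingSchedule

variable (hδ : IsSmoothingSchedule T k r ν δ) (hr : 0 < r) (hN : 0 < ν * k) (τ : Timeline T)

include hδ hr hN

lemma div_le_lossScale (m : Fin T) :
    ν * k * r / δ ((τ.obsOrder m : ℕ) + 1) ≤ lossScale k r ν δ τ m := by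
  have hround := τ.add_delay_lt (τ.obsOrder m)
  have hanti := hδ.anti ((τ.obsOrder m : ℕ) + 1)
    ((τ.obsOrder m : ℕ) + 1 + τ.delay (τ.obsOrder m)) (by lia) (by lia)
  have hpos := hδ.pos ((τ.obsOrder m : ℕ) + 1 + τ.delay (τ.obsOrder m)) (by lia) (by lia)
  unfold lossScale
  gcongr

omit τ in
lemma div_le_sqrt_mul (hNT : ν * k ≤ √T) (t : Fin T) :
    ν * k * r / δ ((t : ℕ) + 1) ≤ √(ν * k) * (T : ℝ) ^ (1 / 4 : ℝ) := by
  have hq : 0 < (T : ℝ) ^ (1 / 4 : ℝ) := Real.rpow_pos_of_pos (by exact_mod_cast t.pos) _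
  rw [div_le_iff₀ (hδ.pos _ (by lia) t.2)]
  calc ν * k * r = √(ν * k) * (T : ℝ) ^ (1 / 4 : ℝ)
        * (r * (√(ν * k) / (T : ℝ) ^ (1 / 4 : ℝ))) := by
        field_simp
        rw [Real.sq_sqrt hN.le]
    _ ≤ _ := by
        gcongr
        exact hδ.lower hNT _ (by lia) t.2

variable (hD : 0 < D) (hG : 0 < G)

include hD hG

lemma linearRegretBound_le [NeZero T] (hNT : ν * k ≤ √T) (hNT' : 1 ≤ ν * k * √T) :
    linearRegretBound k (learningRate k D G r ν δ τ) δ τ D (ν * (G * r))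
      ≤ G * D * (√(τ.totalDelay : ℝ) / 2 + 2 * ((T : ℝ) ^ (3 / 4 : ℝ) * √(ν * k))) := by
  set η := learningRate k D G r ν δ τ
  have hlast : 0 < rateSum k r ν δ τ T := by
    simpa [Nat.sub_add_cancel (NeZero.one_le (n := T))] using rateSum_succ_pos k r ν δ τ (T - 1)
  have hregularization : D ^ 2 / (2 * η T) = G * D / 2 * √(rateSum k r ν δ τ T) := by
    have := Real.sqrt_pos.2 hlast
    rw [show η T = D / G / √(rateSum k r ν δ τ T) from rfl]
    field_simp
  have hstability : ∑ m : Fin T,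
      η ((m : ℕ) + 1) * (k * (ν * (G * r)) / δ ((τ.obsOrder m : ℕ) + 1)) ^ 2 / 2
      ≤ G ^ 2 / 2 * ∑ m, lossScale k r ν δ τ m ^ 2 * η ((m : ℕ) + 1) := by
    rw [Finset.mul_sum]
    refine Finset.sum_le_sum fun m _ => ?_
    have hscale := hδ.div_le_lossScale hr hN τ m
    have hnonneg : 0 ≤ ν * k * r / δ ((τ.obsOrder m : ℕ) + 1) :=
      div_nonneg (by positivity) (hδ.pos _ (by lia) (τ.obsOrder m).2).le
    have hrate := learningRate_succ_pos k r ν δ τ hD hG m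
    calc _ = G ^ 2 / 2 * ((ν * k * r / δ ((τ.obsOrder m : ℕ) + 1)) ^ 2 * η ((m : ℕ) + 1)) := by
          ring
      _ ≤ _ := by gcongr
  calc _ ≤ G * D / 2 * √(rateSum k r ν δ τ T)
        + G ^ 2 / 2 * (D / G * (2 * √(∑ m, lossScale k r ν δ τ m ^ 2))) := by
        rw [linearRegretBound, hregularization]
        gcongr
        refine hstability.trans ?_
        gcongr
        exact sum_lossScale_sq_mul_learningRate_le k r ν δ τ hD hG
    _ = G * D / 2 * √(rateSum k r ν δ τ T) + G * D * √(∑ m, lossScale k r ν δ τ m ^ 2) := by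
        field_simp
    _ ≤ G * D / 2 * (√(τ.totalDelay : ℝ) + 2 * ((T : ℝ) ^ (3 / 4 : ℝ) * √(ν * k)))
        + G * D * ((T : ℝ) ^ (3 / 4 : ℝ) * √(ν * k)) := by
        gcongr
        · exact hδ.sqrt_rateSum_le hr hN τ hNT hNT'
        · exact hδ.sqrt_sum_lossScale_sq_le hr hN τ hNT
    _ = _ := by ring

omit hG in
lemma sqrt_mul_learningRate_seen_le (hG : 0 ≤ G) {t : Fin T} (ht : (t : ℕ) ≤ 2 * τ.seen t) :
    √(ν * k) * learningRate k D G r ν δ τ (τ.seen t + 1)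
      ≤ D / G * (3 * (((t : ℕ) : ℝ) + 1) ^ (-(3 / 4) : ℝ)) := by
  have hrate : 0 < √(rateSum k r ν δ τ (τ.seen t + 1)) :=
    Real.sqrt_pos.2 (rateSum_succ_pos k r ν δ τ _)
  have hpow : 0 < (((t : ℕ) : ℝ) + 1) ^ (3 / 4 : ℝ) := by positivity
  have hratio : √(ν * k) / √(rateSum k r ν δ τ (τ.seen t + 1))
      ≤ 3 / (((t : ℕ) : ℝ) + 1) ^ (3 / 4 : ℝ) := by
    rw [div_le_div_iff₀ hrate hpow]
    exact hδ.sqrt_mul_rpow_le_sqrt_rateSum hr hN τ ht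
  rw [learningRate_eq, Real.rpow_neg (by positivity), ← div_eq_mul_inv]
  calc _ = D / G * (√(ν * k) / √(rateSum k r ν δ τ (τ.seen t + 1))) := by ring
    _ ≤ _ := by gcongr

-- If round `t` has seen less than half of the feedback, the diameter bounds the drift; such rounds
-- are rare. Otherwise the learning rate at `l_t` is already as small as `t^{-3/4}`.
lemma drift_le (t : Fin T) :
    G * min D ((G * (√(ν * k) * (T : ℝ) ^ (1 / 4 : ℝ))) ^ 2 / G
        * learningRate k D G r ν δ τ (τ.seen t + 1)
      + ∑ j ∈ Finset.Ico (τ.seen t) (τ.obsPos t), 2 * G * learningRate k D G r ν δ τ (j + 1))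
      ≤ G * D * (if 2 * τ.seen t < t then 1 else 0)
        + 3 * (G * D) * √(ν * k) * ((T : ℝ) ^ (1 / 4 : ℝ)) ^ 2
          * (((t : ℕ) : ℝ) + 1) ^ (-(3 / 4) : ℝ)
        + ∑ j ∈ Finset.Ico (τ.seen t) (τ.obsPos t),
            2 * G ^ 2 * learningRate k D G r ν δ τ (j + 1) := by
  set η := learningRate k D G r ν δ τ
  set q := (T : ℝ) ^ (1 / 4 : ℝ)
  have hη : ∀ n, 0 < η (n + 1) := learningRate_succ_pos k r ν δ τ hD hG
  split_ifs with hfew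
  · have hsum : 0 ≤ ∑ j ∈ Finset.Ico (τ.seen t) (τ.obsPos t), 2 * G ^ 2 * η (j + 1) :=
      Finset.sum_nonneg fun j _ => mul_nonneg (by positivity) (hη j).le
    have hnoise : 0 ≤ 3 * (G * D) * √(ν * k) * q ^ 2 * (((t : ℕ) : ℝ) + 1) ^ (-(3 / 4) : ℝ) := by
      positivity
    linarith [mul_le_mul_of_nonneg_left (min_le_left D ((G * (√(ν * k) * q)) ^ 2 / G
      * η (τ.seen t + 1) + ∑ j ∈ Finset.Ico (τ.seen t) (τ.obsPos t), 2 * G * η (j + 1))) hG.le]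
  · rw [mul_zero, zero_add]
    refine (mul_le_mul_of_nonneg_left (min_le_right _ _) hG.le).trans ?_
    rw [mul_add, Finset.mul_sum]
    refine add_le_add ?_ (Finset.sum_congr rfl fun j _ => by ring).le
    have hseen : (t : ℕ) ≤ 2 * τ.seen t := by lia
    calc _ = G ^ 2 * √(ν * k) * q ^ 2 * (√(ν * k) * η (τ.seen t + 1)) := by field_simp
      _ ≤ G ^ 2 * √(ν * k) * q ^ 2
          * (D / G * (3 * (((t : ℕ) : ℝ) + 1) ^ (-(3 / 4) : ℝ))) := by
          gcongr _ * ?_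
          exact hδ.sqrt_mul_learningRate_seen_le hr hN τ hD hG.le hseen
      _ = _ := by field_simp

lemma sum_drift_le :
    ∑ t : Fin T, G * min D ((G * (√(ν * k) * (T : ℝ) ^ (1 / 4 : ℝ))) ^ 2 / G
        * learningRate k D G r ν δ τ (τ.seen t + 1)
      + ∑ j ∈ Finset.Ico (τ.seen t) (τ.obsPos t), 2 * G * learningRate k D G r ν δ τ (j + 1))
      ≤ G * D * (6 * √(τ.totalDelay : ℝ) + 12 * ((T : ℝ) ^ (3 / 4 : ℝ) * √(ν * k))) := by
  have hrare : ∑ t : Fin T, (if 2 * τ.seen t < t then (1 : ℝ) else 0)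
      ≤ 2 * √(τ.totalDelay : ℝ) := by
    rw [Finset.sum_boole]
    exact τ.card_filter_two_mul_seen_lt_le
  have hpow : ∑ t : Fin T, (((t : ℕ) : ℝ) + 1) ^ (-(3 / 4) : ℝ) ≤ 4 * (T : ℝ) ^ (1 / 4 : ℝ) := by
    refine (sum_rpow_neg_le (by norm_num) (by norm_num) T).trans_eq ?_
    norm_num
    ring
  have hbacklog : ∑ t, ∑ j ∈ Finset.Ico (τ.seen t) (τ.obsPos t),
      2 * G ^ 2 * learningRate k D G r ν δ τ (j + 1) ≤ 4 * (G * D) * √(τ.totalDelay : ℝ) := by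
    rw [τ.sum_sum_Ico_seen_obsPos fun j => 2 * G ^ 2 * learningRate k D G r ν δ τ (j + 1)]
    calc _ = 2 * G ^ 2 * ∑ m, (τ.dualBacklog (τ.obsOrder m) : ℝ)
            * learningRate k D G r ν δ τ ((m : ℕ) + 1) := by
          rw [Finset.mul_sum]
          exact Finset.sum_congr rfl fun m _ => by ring
      _ ≤ 2 * G ^ 2 * (D / G * (2 * √(τ.totalDelay : ℝ))) := by
          gcongr
          exact sum_dualBacklog_mul_learningRate_le k r ν δ τ hD hG
      _ = _ := by field_simp; ring
  refine (Finset.sum_le_sum fun t _ => hδ.drift_le hr hN τ hD hG t).trans ?_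
  rw [Finset.sum_add_distrib, Finset.sum_add_distrib, ← Finset.mul_sum, ← Finset.mul_sum]
  calc _ ≤ G * D * (2 * √(τ.totalDelay : ℝ))
        + 3 * (G * D) * √(ν * k) * ((T : ℝ) ^ (1 / 4 : ℝ)) ^ 2 * (4 * (T : ℝ) ^ (1 / 4 : ℝ))
        + 4 * (G * D) * √(τ.totalDelay : ℝ) := by gcongr
    _ = _ := by
        rw [← rpow_one_quarter_pow_three T.cast_nonneg]
        ring

end IsSmoothingSchedule

lemma le_rpow_three_quarters_mul_sqrt {x N : ℝ} (hx : 0 ≤ x) (h : √x ≤ N) :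
    x ≤ x ^ (3 / 4 : ℝ) * √N := by
  have hq : x ^ (1 / 4 : ℝ) ≤ √N := by
    refine Real.le_sqrt_of_sq_le ?_
    rwa [rpow_one_quarter_pow_two hx]
  calc x = x ^ (3 / 4 : ℝ) * x ^ (1 / 4 : ℝ) := by
        rw [← rpow_one_quarter_pow_three hx, ← pow_succ, rpow_one_quarter_pow_four hx]
    _ ≤ _ := by gcongr

lemma mul_le_rpow_three_quarters_mul_sqrt {x N : ℝ} (hx : 0 ≤ x) (hN : 0 ≤ N) (h : N * √x ≤ 1) :
    x * N ≤ x ^ (3 / 4 : ℝ) * √N := by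
  have hq : x ^ (1 / 4 : ℝ) * √N ≤ 1 := by
    rwa [← sq_le_one_iff₀ (by positivity), mul_pow, rpow_one_quarter_pow_two hx, Real.sq_sqrt hN,
      mul_comm]
  calc x * N = x ^ (3 / 4 : ℝ) * √N * (x ^ (1 / 4 : ℝ) * √N) := by
        nth_rw 1 [← rpow_one_quarter_pow_four hx, ← Real.sq_sqrt hN]
        rw [← rpow_one_quarter_pow_three hx]
        ring
    _ ≤ _ := mul_le_of_le_one_right (by positivity) hq

end Tuning

section MainBound

variable {k T : ℕ} [NeZero k] {K : Set (Eucl k)} {z₁ : Eucl k} {r ν : ℝ} {δ : ℕ → ℝ}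
  {f : Fin T → Eucl k → ℝ} {D : ℝ} {G : ℝ≥0} {τ : Timeline T}
  (H : WrapperAssumptions K z₁ (learningRate k D G r ν δ τ) r δ f D G (ν * (G * r)))
  (hδ : IsSmoothingSchedule T k r ν δ) (hν : 0 < ν) {x : Eucl k} (hx : x ∈ K)

namespace WrapperAssumptions

include H hδ hν hx

lemma integral_regret_le_of_regime (hNT : ν * k ≤ √T) (hNT' : 1 ≤ ν * k * √T) :
    ∫ u, wrapperRegret (pftrl K z₁ (learningRate k D G r ν δ τ)) r δ τ f u x ∂(directionLaw k T)
      ≤ 24 * (G * D * (√(τ.totalDelay : ℝ) + (T : ℝ) ^ (3 / 4 : ℝ) * √(ν * k))) := by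
  have hr := H.r_pos
  have hD := H.diam_pos
  have hG : (0 : ℝ) < G := H.G_pos
  have hN : 0 < ν * k := mul_pos hν (Nat.cast_pos.2 (NeZero.pos k))
  have : NeZero T := ⟨by rintro rfl; norm_num at hNT'⟩
  have hT : (0 : ℝ) < T := Nat.cast_pos.2 (NeZero.pos T)
  have hL : ∀ t : Fin T,
      k * (ν * (G * r)) / δ ((t : ℕ) + 1) ≤ G * (√(ν * k) * (T : ℝ) ^ (1 / 4 : ℝ)) := fun t => by
    calc _ = G * (ν * k * r / δ ((t : ℕ) + 1)) := by ring
      _ ≤ _ := by gcongr; exact hδ.div_le_sqrt_mul hr hN hNT t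
  have hbias : ∑ t : Fin T, 7 * (G * D) * (δ ((t : ℕ) + 1) / r)
      ≤ 7 * (G * D) * (4 / 3 * ((T : ℝ) ^ (3 / 4 : ℝ) * √(ν * k))) := by
    rw [← Finset.mul_sum]
    gcongr
    exact hδ.sum_div_le hr
  have hdelay : 0 ≤ G * D * √(τ.totalDelay : ℝ) := by positivity
  have hhorizon : 0 ≤ G * D * ((T : ℝ) ^ (3 / 4 : ℝ) * √(ν * k)) := by positivity
  linarith [H.integral_regret_le τ hL (by positivity) hx, hδ.sum_drift_le hr hN τ hD hG,
    hδ.linearRegretBound_le hr hN τ hD hG hNT hNT']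

-- Outside of the main regime the bound is trivial: if `νk > √T` because the losses are Lipschitz,
-- and if `νk√T < 1` because they are bounded.
lemma integral_regret_le_of_schedule :
    ∫ u, wrapperRegret (pftrl K z₁ (learningRate k D G r ν δ τ)) r δ τ f u x ∂(directionLaw k T)
      ≤ 24 * (G * D * (√(τ.totalDelay : ℝ) + (T : ℝ) ^ (3 / 4 : ℝ) * √(ν * k))) := by
  have hD := H.diam_pos
  have hk : (1 : ℝ) ≤ k := Nat.one_le_cast.2 NeZero.one_le
  have hdelay : 0 ≤ G * D * √(τ.totalDelay : ℝ) := by positivity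
  have hhorizon : 0 ≤ G * D * ((T : ℝ) ^ (3 / 4 : ℝ) * √(ν * k)) := by positivity
  rcases le_or_gt (ν * k) √T with hNT | hNT
  · rcases le_or_gt 1 (ν * k * √T) with hNT' | hNT'
    · exact H.integral_regret_le_of_regime hδ hν hx hNT hNT'
    · have hbound : (T : ℝ) * (2 * (ν * (G * r)))
          ≤ 2 * (G * D * ((T : ℝ) ^ (3 / 4 : ℝ) * √(ν * k))) := by
        calc (T : ℝ) * (2 * (ν * (G * r))) = 2 * (G * r * (T * (ν * 1))) := by ring
          _ ≤ 2 * (G * D * (T * (ν * k))) := by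
              gcongr
              exact H.r_le_diam
          _ ≤ _ := by
              gcongr 2 * (G * D * ?_)
              exact mul_le_rpow_three_quarters_mul_sqrt T.cast_nonneg (by positivity) hNT'.le
      linarith [H.integral_regret_le_of_bounded τ hx]
  · have hbound : (T : ℝ) * (G * D) ≤ G * D * ((T : ℝ) ^ (3 / 4 : ℝ) * √(ν * k)) := by
      rw [mul_comm]
      gcongr
      exact le_rpow_three_quarters_mul_sqrt T.cast_nonneg hNT.le
    linarith [H.integral_regret_le_of_lipschitz τ hx]

end WrapperAssumptions

end MainBound

lemma lipschitzOnWith_of_norm_gradientWithin_le {E : Type*} [NormedAddCommGroup E]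
    [InnerProductSpace ℝ E] [CompleteSpace E] {K : Set E} {f : E → ℝ} {G : ℝ≥0}
    (hK : Convex ℝ K) (hf : DifferentiableOn ℝ f K) (hG : ∀ x ∈ K, ‖gradientWithin f K x‖ ≤ G) :
    LipschitzOnWith G f K :=
  hK.lipschitzOnWith_of_nnnorm_fderivWithin_le hf fun x hx => by
    simpa [gradientWithin, ← NNReal.coe_le_coe] using hG x hx

theorem mainTheorem1_general {k T : ℕ} {K : Set (Eucl k)} {f : Fin T → Eucl k → ℝ}
    (τ : Timeline T) {D M r ν : ℝ} {G : ℝ≥0} {z₁ x : Eucl k} {δ : ℕ → ℝ} (hk : 1 ≤ k)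
    (hclosed : IsClosed K) (hconvex : Convex ℝ K) (hG : 0 < G) (hM : 0 < M) (hr : 0 < r)
    (hball : closedBall 0 r ⊆ K) (hdiam : ∀ x ∈ K, ∀ y ∈ K, ‖x - y‖ ≤ D)
    (hfconvex : ∀ t, ConvexOn ℝ K (f t)) (hflipschitz : ∀ t, LipschitzOnWith G (f t) K)
    (hfbounded : ∀ t, ∀ x ∈ K, |f t x| ≤ M) (hν : ν = M / (G * r))
    (hδ : δ = roundSchedule k r ν ∨ δ = fixedSchedule k T r ν) (hz₁ : z₁ ∈ K) (hx : x ∈ K) :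
    Integrable (fun u => wrapperRegret (pftrl K z₁ (learningRate k D G r ν δ τ)) r δ τ f u x)
        (directionLaw k T) ∧
      ∫ u, wrapperRegret (pftrl K z₁ (learningRate k D G r ν δ τ)) r δ τ f u x ∂(directionLaw k T)
        ≤ 24 * (G * D * (√(τ.totalDelay : ℝ) + (T : ℝ) ^ (3 / 4 : ℝ) * √(ν * k))) := by
  have : NeZero k := ⟨by lia⟩
  have hν0 : 0 < ν := hν ▸ by positivity
  have hN : 0 < ν * k := mul_pos hν0 (Nat.cast_pos.2 hk)
  have hMν : M = ν * (G * r) := by rw [hν]; field_simp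
  have hschedule : IsSmoothingSchedule T k r ν δ := by
    rcases hδ with rfl | rfl
    exacts [isSmoothingSchedule_roundSchedule hr hN, isSmoothingSchedule_fixedSchedule hr hN]
  have hD : 0 < D := hr.trans_le (le_diam_of_closedBall_subset hr.le hball hdiam)
  have H : WrapperAssumptions K z₁ (learningRate k D G r ν δ τ) r δ f D G (ν * (G * r)) :=
    { compact := isCompact_of_isClosed_isBounded hclosed
        (isBounded_iff.2 ⟨D, fun x hx y hy => (dist_eq_norm x y).trans_le (hdiam x hx y hy)⟩)
      convex := hconvex
      start_mem := hz₁
      r_pos := hr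
      ball_subset := hball
      diam_le := hdiam
      rate_pos := learningRate_succ_pos k r ν δ τ hD hG
      weight_nonneg := stepWeight_learningRate_nonneg k r ν δ τ hD hG
      delta_pos := fun t => hschedule.pos _ (by lia) t.2
      delta_le := fun t => hschedule.le _
      G_pos := hG
      loss_convex := hfconvex
      loss_lipschitz := hflipschitz
      loss_bounded := hMν ▸ hfbounded }
  exact ⟨H.integrable_regret τ x, H.integral_regret_le_of_schedule hschedule hν0 hx⟩

theorem mainTheorem1 :
    ∃ C : ℝ, 0 < C ∧
      ∀ (k T : ℕ) (K : Set (Eucl k)) (f : Fin T → Eucl k → ℝ) (τ : Timeline T)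
        (D G M r R ν : ℝ) (z₁ xstar : Eucl k) (δ : ℕ → ℝ),
        1 ≤ k →
        IsClosed K → Convex ℝ K →
        0 < G → 0 < M → 0 < r → r < R →
        Metric.closedBall 0 r ⊆ K → K ⊆ Metric.closedBall 0 R →
        (∀ x ∈ K, ∀ y ∈ K, ‖x - y‖ ≤ D) →
        (∀ t, ConvexOn ℝ K (f t)) →
        (∀ t, DifferentiableOn ℝ (f t) K) →
        (∀ t, ∀ x ∈ K, ‖gradientWithin (f t) K x‖ ≤ G) →
        (∀ t, ∀ x ∈ K, |f t x| ≤ M) →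
        ν = M / (G * r) →
        (δ = roundSchedule k r ν ∨ δ = fixedSchedule k T r ν) →
        z₁ ∈ K →
        xstar ∈ K → IsMinOn (fun x => ∑ t, f t x) K xstar →
        Integrable
            (fun u => wrapperRegret (pftrl K z₁ (learningRate k D G r ν δ τ)) r δ τ f u xstar)
            (directionLaw k T) ∧
          ∫ u, wrapperRegret (pftrl K z₁ (learningRate k D G r ν δ τ)) r δ τ f u xstar
              ∂(directionLaw k T)
            ≤ C * (G * D * (√(τ.totalDelay : ℝ) + (T : ℝ) ^ (3 / 4 : ℝ) * √(ν * k))) := by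
  refine ⟨24, by norm_num, fun k T K f τ D G M r R ν z₁ xstar δ hk hclosed hconvex hG hM hr _ hball
    _ hdiam hfconvex hfdiff hfgrad hfbounded hν hδ hz₁ hx _ => ?_⟩
  lift G to ℝ≥0 using hG.le
  exact mainTheorem1_general τ hk hclosed hconvex hG hM hr hball hdiam hfconvex
    (fun t => lipschitzOnWith_of_norm_gradientWithin_le hconvex (hfdiff t) (hfgrad t))
    hfbounded hν hδ hz₁ hx
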